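/- **Model.** Consider a fog radio access network with two edge nodes (ENs) $m\in\{1,2\}$, two users $k\in\{1,2\}$ and a library of $J$ independent files $F_1,\dots,F_J$, each uniformly distributed on $\{0,1\}^L$. The channel coefficients $H_{m,k}\in\mathbb C$ are i.i.d. with an atomless law, constant during a transmission, independent of the files, and known everywhere; write $\mathcal H=(H_{m,k})$. Logarithms are to base $2$, entropies are in bits, $P>1$ is the SNR and $r>0$ the fronthaul rate. Let $\boldsymbol\mu=(\mu_{m,j})$, $m\in\{1,2\}$, $1\le j\le J$, be a cache partition matrix with entries in $[0,1]$ (possibly $\mu_{1,j}\ne\mu_{2,j}$). A policy for $(L,P)$ consists of the following. EN $m$ caches $S_{m,j}=\pi^c_{m,j}(F_j)$ with $H(S_{m,j})\le\mu_{m,j}L$ for every $j$. For each request vector $D=(D_1,D_2)$ with $D_1\neq D_2$ there are durations $n^f_D,n^e_D\in\mathbb N$; the cloud sends to EN $m$ a message $U_m=\pi^f_m(D,F_1,\dots,F_J,\mathcal H)$ with $H(U_m\mid\mathcal H)\le n^f_D\,r\log P$; EN $m$ transmits $X_m=\pi^e_m(D,(S_{m,j})_j,U_m,\mathcal H)\in\mathbb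 C^{n^e_D}$ with $\mathbb E\|X_m\|^2\le n^e_D P$; user $k$ receives $Y_k=\sum_{m=1}^2H_{m,k}X_m+Z_k$, where the entries of $Z_k$ are i.i.d. circularly symmetric complex Gaussian of unit power, independent of everything else, and decodes $\hat F_{k}=\pi^d_k(Y_k,D,\mathcal H)$. Let $P_e=\max_D\max_k\Pr(\hat F_k\ne F_{D_k})$. A family of policies indexed by $(L,P)$ is feasible if $\lim_{P\to\infty}\lim_{L\to\infty}P_e=0$. Its fronthaul and edge normalized delivery times (NDTs) are $\delta^x_D=\lim_{P\to\infty}\lim_{L\to\infty}\frac{n^x_D}{L/\log P}$, $x\in\{f,e\}$, and $\delta_D=\delta^f_D+\delta^e_D$; these limits are required to exist, and $\delta_D$ is required to be the same for both orderings of $D$, so that it is written $\delta_{i,j}$ for $D=\{i,j\}$. The NDT region $\Delta^*(\boldsymbol\mu,r)$ is the set of all tuples $(\delta_{i,j})_{\{i,j\}\subseteq\{1,\dots,J\},\,i\ne j}$ obtained from feasible families. **Theorem.** For every $r>0$ and every cache partition matrix $\boldsymbol\mu$, every tuple in $\Delta^*(\boldsymbol\mu,r)$ satisfies $\delta_{i,j}\ge\delta^{(\mathrm{out})}_{i,j}(\boldsymbol\mu,r)$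 for all $i\ne j$, where, with $\underline\mu_{i,j}=\min\{\mu_{1,i},\mu_{2,i},\mu_{1,j},\mu_{2,j}\}$, $$\delta^{(\mathrm{out})}_{i,j}(\boldsymbol\mu,r)=\begin{cases}\max\{a_1,a_2,a_3\},& r\le1,\\ 1+\frac1r-\frac1r\,\underline\mu_{i,j},& r>1,\end{cases}$$ $$a_1=1+\tfrac1r-\underline\mu_{i,j}-\tfrac12\left(\tfrac1r-1\right)(\mu_{1,i}+\mu_{2,i}+\mu_{1,j}+\mu_{2,j}),$$ $$a_2=\tfrac32+\tfrac1{2r}-\underline\mu_{i,j}-\tfrac12\left(\tfrac1r-1\right)\min\{\mu_{1,i}+\mu_{2,i},\ \mu_{1,j}+\mu_{2,j}\},\qquad a_3=2-\underline\mu_{i,j}.$$ -/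

import Mathlib

open MeasureTheory ProbabilityTheory Filter Topology

noncomputable section

namespace FRAN

/-! Fog radio access network with two edge nodes (ENs), two users and a library of `J` files. -/

/-- A file of `L` bits. -/
abbrev File (L : ℕ) : Type := Fin L → Bool

/-- The content library: `J` files of `L` bits each. -/
abbrev Library (J L : ℕ) : Type := Fin J → File L

/-- Channel state information: `h m k` is the coefficient from EN `m` to user `k`. -/
abbrev CSI : Type := Fin 2 → Fin 2 → ℂ

/-- A block of `n` complex channel symbols. -/
abbrev Signal (n : ℕ) : Type := Fin n → ℂ

/-- A request vector: user `k` requests the file with index `D k`; requested files are distinct. -/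
abbrev Demand (J : ℕ) : Type := Fin 2 ↪ Fin J

/-- The files are independent and uniformly distributed bit strings. -/
def libraryLaw (J L : ℕ) : Measure (Library J L) := uniformOn Set.univ

/-- The channel coefficients are i.i.d. over ENs and users, with law `ν`. -/
def csiLaw (ν : Measure ℂ) : Measure CSI := Measure.pi fun _ => Measure.pi fun _ => ν

/-- Circularly symmetric complex Gaussian law with unit power: independent real and imaginary
parts of variance `1 / 2`. -/
def complexGaussian : Measure ℂ :=
  ((gaussianReal 0 (1 / 2)).prod (gaussianReal 0 (1 / 2))).map
    (fun p : ℝ × ℝ => (⟨p.1, p.2⟩ : ℂ))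

/-- Receiver noise: i.i.d. over the two users and the `n` symbols. -/
def noiseLaw (n : ℕ) : Measure (Fin 2 → Signal n) :=
  Measure.pi fun _ => Measure.pi fun _ => complexGaussian

/-- Joint law of the files, the channel and the noise, which are independent. -/
def systemLaw (J L n : ℕ) (ν : Measure ℂ) :
    Measure (Library J L × CSI × (Fin 2 → Signal n)) :=
  (libraryLaw J L).prod ((csiLaw ν).prod (noiseLaw n))

/-- Shannon entropy, in bits, of a random variable on a finite probability space. -/
def entropy {Ω : Type*} [Fintype Ω] [MeasurableSpace Ω] (p : Measure Ω) (X : Ω → ℕ) : ℝ :=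
  ∑ a ∈ Finset.univ.image X, Real.negMulLog (p.real (X ⁻¹' {a})) / Real.log 2

/-- A caching, fronthaul, edge transmission and decoding policy for files of `L` bits, together
with the durations (in channel symbols) of the two delivery subslots for each request vector.
As the library is finite, it is no restriction that cached contents and fronthaul
messages are labelled by natural numbers. -/
structure Policy (J L : ℕ) where
  /-- Duration `n^f_D` of the fronthaul subslot. -/
  fronthaulTime : Demand J → ℕ
  /-- Duration `n^e_D` of the edge subslot. -/
  edgeTime : Demand J → ℕ
  /-- `S_{m,j}` as a function of the file `F_j`. -/
  cache : Fin 2 → Fin J → File L → ℕ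
  /-- `U_m` as a function of the demand, the library and the CSI. -/
  fronthaul : Fin 2 → Demand J → Library J L → CSI → ℕ
  /-- `X_m` as a function of the demand, `(S_{m,j})_j`, `U_m` and the CSI. -/
  edge : Fin 2 → (D : Demand J) → (Fin J → ℕ) → ℕ → CSI → Signal (edgeTime D)
  /-- The decision of user `k`, as a function of the demand, `Y_k` and the CSI. -/
  decode : Fin 2 → (D : Demand J) → Signal (edgeTime D) → CSI → File L
  measurable_fronthaul : ∀ m D F, Measurable (fronthaul m D F)
  measurable_edge : ∀ m D s u, Measurable (edge m D s u)
  measurable_decode : ∀ k D, Measurable fun p : Signal (edgeTime D) × CSI => decode k D p.1 p.2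

namespace Policy

variable {J L : ℕ} (π : Policy J L)

/-- The codeword `X_m` transmitted by EN `m`. -/
def codeword (m : Fin 2) (D : Demand J) (F : Library J L) (h : CSI) : Signal (π.edgeTime D) :=
  π.edge m D (fun j => π.cache m j (F j)) (π.fronthaul m D F h) h

/-- The received signal `Y_k = ∑ m, H_{m,k} X_m + Z_k`. -/
def received (k : Fin 2) (D : Demand J) (F : Library J L) (h : CSI)
    (z : Fin 2 → Signal (π.edgeTime D)) : Signal (π.edgeTime D) :=
  fun t => ∑ m, h m k * π.codeword m D F h t + z k t

/-- Error probability of user `k` for the request vector `D`. -/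
def errorProb (ν : Measure ℂ) (D : Demand J) (k : Fin 2) : ℝ :=
  (systemLaw J L (π.edgeTime D) ν).real
    {ω | π.decode k D (π.received k D ω.1 ω.2.1 ω.2.2) ω.2.1 ≠ ω.1 (D k)}

/-- Worst-case error probability over requests and users. -/
def maxErrorProb (ν : Measure ℂ) : ℝ := ⨆ D : Demand J, ⨆ k : Fin 2, π.errorProb ν D k

/-- At EN `m` the content cached of file `j` has entropy at most `μ m j * L` bits. -/
def CacheConstraint (μ : Fin 2 → Fin J → ℝ) : Prop :=
  ∀ m j, entropy (libraryLaw J L) (fun F => π.cache m j (F j)) ≤ μ m j * L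

/-- The fronthaul links have capacity `r log₂ P` bits per symbol. The CSI is known throughout the
network, so the entropy of `U_m` is the one given the CSI. -/
def FronthaulConstraint (ν : Measure ℂ) (r P : ℝ) : Prop :=
  ∀ m D, ∫ h, entropy (libraryLaw J L) (fun F => π.fronthaul m D F h) ∂(csiLaw ν)
    ≤ r * Real.logb 2 P * π.fronthaulTime D

/-- The average transmit power of each EN is at most `P` per symbol. -/
def PowerConstraint (ν : Measure ℂ) (P : ℝ) : Prop :=
  ∀ m D, ∫⁻ ω, ENNReal.ofReal (∑ t, ‖π.codeword m D ω.1 ω.2 t‖ ^ 2)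
      ∂((libraryLaw J L).prod (csiLaw ν))
    ≤ ENNReal.ofReal (π.edgeTime D * P)

end Policy

/-- The iterated limit `lim_{P → ∞} lim_{L → ∞} f L P` exists and equals `a`. -/
def IteratedLimit (f : ℕ → ℝ → ℝ) (a : ℝ) : Prop :=
  ∃ g : ℝ → ℝ, (∀ᶠ P in atTop, Tendsto (fun L => f L P) atTop (𝓝 (g P))) ∧
    Tendsto g atTop (𝓝 a)

/-- A set of two distinct requested files. -/
abbrev RequestSet (J : ℕ) : Type := {s : Finset (Fin J) // s.card = 2}

/-- The request set `{i, j}`. -/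
def pairSet {J : ℕ} (i j : Fin J) (hij : i ≠ j) : RequestSet J := ⟨{i, j}, Finset.card_pair hij⟩

/-- The set of files requested in the request vector `D`. -/
def Demand.toSet {J : ℕ} (D : Demand J) : RequestSet J :=
  ⟨Finset.univ.map D, by simp⟩

/-- The family `π`, parametrized by the file length `L` and the SNR `P`, meets the cache, fronthaul
and power constraints, and is feasible: its error probability vanishes. -/
structure IsFeasible {J : ℕ} (ν : Measure ℂ) (r : ℝ) (μ : Fin 2 → Fin J → ℝ)
    (π : (L : ℕ) → ℝ → Policy J L) : Prop where
  cache : ∀ L P, 1 < P → (π L P).CacheConstraint μ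
  fronthaul : ∀ L P, 1 < P → (π L P).FronthaulConstraint ν r P
  power : ∀ L P, 1 < P → (π L P).PowerConstraint ν P
  error : IteratedLimit (fun L P => (π L P).maxErrorProb ν) 0

/-- The NDT region for a given cache partition matrix: all tuples `δ`, indexed by request sets, such
that some feasible family has fronthaul and edge NDTs that sum to `δ` at the request set, for both
orderings of each request set. -/
def ndtRegion {J : ℕ} (ν : Measure ℂ) (r : ℝ) (μ : Fin 2 → Fin J → ℝ) :
    Set (RequestSet J → ℝ) :=
  {δ | ∃ π : (L : ℕ) → ℝ → Policy J L, IsFeasible ν r μ π ∧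
    ∃ δf δe : Demand J → ℝ,
      (∀ D, IteratedLimit
        (fun L P => ((π L P).fronthaulTime D : ℝ) / ((L : ℝ) / Real.logb 2 P)) (δf D)) ∧
      (∀ D, IteratedLimit
        (fun L P => ((π L P).edgeTime D : ℝ) / ((L : ℝ) / Real.logb 2 P)) (δe D)) ∧
      ∀ D : Demand J, δ D.toSet = δe D + δf D}

section OuterBound

variable {J : ℕ} (μ : Fin 2 → Fin J → ℝ) (r : ℝ) (i j : Fin J)

/-- `min {μ_{1,i}, μ_{2,i}, μ_{1,j}, μ_{2,j}}`. -/
def minCache : ℝ := min (min (μ 0 i) (μ 1 i)) (min (μ 0 j) (μ 1 j))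

def outer1 : ℝ :=
  1 + 1 / r - minCache μ i j
    - 1 / 2 * (1 / r - 1) * (μ 0 i + μ 1 i + μ 0 j + μ 1 j)

def outer2 : ℝ :=
  3 / 2 + 1 / (2 * r) - minCache μ i j
    - 1 / 2 * (1 / r - 1) * min (μ 0 i + μ 1 i) (μ 0 j + μ 1 j)

def outer3 : ℝ := 2 - minCache μ i j

def outer4 : ℝ := 1 + 1 / r - 1 / r * minCache μ i j

/-- The lower bound on the NDT of the request set `{i, j}`; it is symmetric in `i` and `j`. -/
def outerBound : ℝ :=
  if r ≤ 1 then max (outer1 μ r i j) (max (outer2 μ r i j) (outer3 μ i j))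
  else outer4 μ r i j

/-- The tuples that satisfy the lower bound at every request set. -/
def outerRegion : Set (RequestSet J → ℝ) :=
  {δ | ∀ (i j : Fin J) (hij : i ≠ j), outerBound μ r i j ≤ δ (pairSet i j hij)}

end OuterBound

end FRAN

end

noncomputable section

namespace FRAN

open scoped ENNReal NNReal

/-! ### Gaussian noise and Gaussian reference measures -/

/-! Write `x` for the edge NDT and `y` for the fronthaul NDT of a request. Three families of
inequalities carry the theorem. (1) `1 ≤ x`: a user decodes from its received signal alone
(`Policy.edge_bound`). (2) `2 ≤ x + r y + μ m (D l)` for every EN `m` and user `l`. The signal of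
the other user `k` yields the file of `k`; that file, the fronthaul message of EN `m` and its cached
part of the file of `l` give the codeword `X_m`. Now `Y_l` is a multiple of `Y_k`, plus a multiple
of `X_m`, plus noise of bounded power, so the file of `l` follows as well
(`Policy.edge_fronthaul_bound`). (3) `|A| ≤ 2 r y` plus the cached fractions of the files requested
by the users in `A`: both fronthaul messages and these cached parts determine all transmitted
signals (`Policy.fronthaul_bound`). `outerBound_le` combines them linearly.

Each bound comes from one guessing argument rather than from differential entropies. Replace the
true output by a Gaussian independent of the files and guess every piece of discrete side
information independently according to its marginal law. The correct files are then identified with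
probability at most `1 / M`, where `M = 2 ^ (L * |A|)`. If the change of measure costs `exp (-cost)`
and the side information has likelihood `p`, the inequality `log t ≤ t` at `t = M * exp (-cost) * p`
gives, on the event of correct decoding, `log M ≤ t + cost - log p`. In expectation `t` contributes
at most 1 and `-log p` contributes the sum of the entropies (`lintegral_correct_mul_log_le`,
`Policy.correct_mul_log_le`). A received signal costs `n log P + O(n)` and the residual noise in (2)
only `O(n)`.

The `O(n)` constants require channel gains with moduli in `[1/K, K]`. They disappear against `log P`
as `P → ∞` (`IteratedLimit.bound`), and only then does `K → ∞`, which exhausts the channel law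
because it has no atom at zero. -/

theorem gaussianReal_half_le_volume :
    gaussianReal 0 (1 / 2) ≤ (ENNReal.ofReal (√Real.pi))⁻¹ • (volume : Measure ℝ) := by
  rw [gaussianReal_of_var_ne_zero 0 (by norm_num), ← withDensity_const]
  refine withDensity_mono (ae_of_all _ fun x => ?_)
  rw [gaussianPDF, ← ENNReal.ofReal_inv_of_pos (by positivity)]
  refine ENNReal.ofReal_le_ofReal ?_
  rw [gaussianPDFReal]
  have h1 : (2 * Real.pi * ((1 / 2 : ℝ≥0) : ℝ)) = Real.pi := by
    push_cast; ring
  rw [h1]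
  refine mul_le_of_le_one_right (by positivity) (Real.exp_le_one_iff.2 ?_)
  have : (0 : ℝ) ≤ 2 * ((1 / 2 : ℝ≥0) : ℝ) := by positivity
  exact div_nonpos_of_nonpos_of_nonneg (by nlinarith [sq_nonneg (x - 0)]) this

theorem complexGaussian_le_volume :
    complexGaussian ≤ (ENNReal.ofReal Real.pi)⁻¹ • (volume : Measure ℂ) := by
  have hm := Complex.volume_preserving_equiv_real_prod.symm
  have hf : (fun p : ℝ × ℝ => (⟨p.1, p.2⟩ : ℂ)) = Complex.measurableEquivRealProd.symm := rfl
  rw [complexGaussian, hf]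
  have h1 : (gaussianReal 0 (1 / 2)).prod (gaussianReal 0 (1 / 2)) ≤
      (ENNReal.ofReal Real.pi)⁻¹ • (volume : Measure (ℝ × ℝ)) := by
    refine (Measure.prod_mono gaussianReal_half_le_volume gaussianReal_half_le_volume).trans ?_
    rw [Measure.prod_smul_left, Measure.prod_smul_right, smul_smul, ← ENNReal.mul_inv,
      ← ENNReal.ofReal_mul (by positivity), Real.mul_self_sqrt Real.pi_pos.le]
    · rfl
    · exact Or.inr ENNReal.ofReal_ne_top
    · exact Or.inl ENNReal.ofReal_ne_top
  refine (Measure.map_mono h1 hm.measurable).trans ?_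
  rw [Measure.map_smul, hm.map_eq]

/-- The product measure comes from the largest outer measure dominated on boxes by the product of
the marginals, so domination has to be checked on boxes only. The constant is moved to the left so
that this maximality applies. -/
theorem pi_le_smul_pi {ι : Type*} [Fintype ι] {α : ι → Type*} [∀ i, MeasurableSpace (α i)]
    {μ ν : ∀ i, Measure (α i)} [∀ i, SigmaFinite (μ i)] [∀ i, SigmaFinite (ν i)] {c : ℝ≥0∞}
    (hc : c ≠ 0) (hc' : c ≠ ⊤) (h : ∀ i, μ i ≤ c • ν i) :
    Measure.pi μ ≤ c ^ Fintype.card ι • Measure.pi ν := by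
  have hn : c ^ Fintype.card ι ≠ 0 := pow_ne_zero _ hc
  have hn' : c ^ Fintype.card ι ≠ ⊤ := ENNReal.pow_ne_top hc'
  have key : ((c ^ Fintype.card ι)⁻¹ • Measure.pi μ).toOuterMeasure ≤
      OuterMeasure.pi fun i => (ν i).toOuterMeasure := by
    rw [OuterMeasure.le_pi]
    intro s _
    simp only [Measure.coe_toOuterMeasure, Measure.smul_apply, smul_eq_mul, Measure.pi_pi]
    rw [ENNReal.inv_mul_le_iff hn hn']
    calc ∏ i, μ i (s i) ≤ ∏ i, c * ν i (s i) := Finset.prod_le_prod' fun i _ => h i (s i)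
      _ = c ^ Fintype.card ι * ∏ i, ν i (s i) := by
        rw [Finset.prod_mul_distrib, Finset.prod_const, Finset.card_univ]
  refine Measure.le_iff.2 fun s hs => ?_
  have := key s
  rw [Measure.coe_toOuterMeasure, Measure.smul_apply, smul_eq_mul, ENNReal.inv_mul_le_iff hn hn']
    at this
  refine this.trans (le_of_eq ?_)
  rw [Measure.smul_apply, smul_eq_mul, Measure.pi, toMeasure_apply _ _ hs]

instance : IsProbabilityMeasure complexGaussian :=
  Measure.isProbabilityMeasure_map
    (Complex.measurableEquivRealProd.symm.measurable.aemeasurable)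

/-- The law of the noise at one receiver. -/
def receiverNoise (n : ℕ) : Measure (Signal n) := Measure.pi fun _ => complexGaussian

instance (n : ℕ) : IsProbabilityMeasure (receiverNoise n) := by
  unfold receiverNoise; infer_instance

instance (n : ℕ) : IsProbabilityMeasure (noiseLaw n) := by
  unfold noiseLaw; infer_instance

/-- Dropping the exponential factor of the density loses only a factor of order `exp n`, which is
negligible at the scale `n log P`. The remaining constant is exactly the prefactor of `gaussianRef`.
-/
theorem receiverNoise_le_volume (n : ℕ) :
    receiverNoise n ≤ (ENNReal.ofReal Real.pi)⁻¹ ^ n • (volume : Measure (Signal n)) := by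
  have hpi : (ENNReal.ofReal Real.pi)⁻¹ ≠ 0 := ENNReal.inv_ne_zero.2 ENNReal.ofReal_ne_top
  have hpi' : (ENNReal.ofReal Real.pi)⁻¹ ≠ ⊤ :=
    ENNReal.inv_ne_top.2 (by simpa using Real.pi_pos)
  have := pi_le_smul_pi (ι := Fin n) hpi hpi' fun _ => complexGaussian_le_volume
  rw [Fintype.card_fin] at this
  exact this

/-- The energy of a block of symbols. -/
def energy {n : ℕ} (x : Signal n) : ℝ := ∑ t, ‖x t‖ ^ 2

theorem energy_nonneg {n : ℕ} (x : Signal n) : 0 ≤ energy x :=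
  Finset.sum_nonneg fun _ _ => sq_nonneg _

@[fun_prop]
theorem measurable_energy {n : ℕ} : Measurable (energy : Signal n → ℝ) := by
  unfold energy; fun_prop

/-- The negative log-likelihood ratio, up to a multiple of the dimension, of a centred Gaussian of
power `s` with respect to Lebesgue measure. -/
def gaussianCost {n : ℕ} (s : ℝ) (y : Signal n) : ℝ := n * Real.log s + energy y / s

@[fun_prop]
theorem measurable_gaussianCost {n : ℕ} (s : ℝ) :
    Measurable (gaussianCost s : Signal n → ℝ) := by
  unfold gaussianCost; fun_prop

/-- The circularly symmetric complex Gaussian law of power `s` per symbol. -/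
def gaussianRef (n : ℕ) (s : ℝ) : Measure (Signal n) :=
  (ENNReal.ofReal Real.pi)⁻¹ ^ n •
    (volume : Measure (Signal n)).withDensity fun y => ENNReal.ofReal (Real.exp (-gaussianCost s y))

theorem lintegral_exp_neg_gaussianCost (n : ℕ) {s : ℝ} (hs : 0 < s) :
    ∫⁻ y : Signal n, ENNReal.ofReal (Real.exp (-gaussianCost s y)) = ENNReal.ofReal Real.pi ^ n := by
  have h1 : ∫ z : ℂ, Real.exp (-s⁻¹ * ‖z‖ ^ 2) = Real.pi * s := by
    rw [GaussianFourier.integral_rexp_neg_mul_sq_norm (inv_pos.2 hs)]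
    simp
  have hi : Integrable fun z : ℂ => s⁻¹ * Real.exp (-s⁻¹ * ‖z‖ ^ 2) := by
    refine Integrable.const_mul ?_ _
    by_contra hcon
    rw [integral_undef hcon] at h1
    have := mul_pos Real.pi_pos hs
    linarith
  have he : ∀ y : Signal n, Real.exp (-gaussianCost s y) =
      ∏ t, s⁻¹ * Real.exp (-s⁻¹ * ‖y t‖ ^ 2) := by
    intro y
    rw [Finset.prod_mul_distrib, Finset.prod_const, ← Real.exp_sum, ← Finset.mul_sum, gaussianCost,
      neg_add, Real.exp_add, Finset.card_univ, Fintype.card_fin, ← mul_neg, ← Real.log_inv,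
      ← Real.log_pow, Real.exp_log (by positivity), energy]
    congr 2
    ring
  simp_rw [he]
  rw [← ofReal_integral_eq_lintegral_ofReal, integral_fintype_prod_volume_eq_pow
    (fun z : ℂ => s⁻¹ * Real.exp (-s⁻¹ * ‖z‖ ^ 2)), integral_const_mul, h1,
    ← ENNReal.ofReal_pow Real.pi_pos.le]
  · congr 1
    rw [Fintype.card_fin]
    field_simp
  · exact Integrable.fintype_prod (f := fun _ z => s⁻¹ * Real.exp (-s⁻¹ * ‖z‖ ^ 2)) fun _ => hi
  · exact ae_of_all _ fun y => Finset.prod_nonneg fun t _ => by positivity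

theorem isProbabilityMeasure_gaussianRef (n : ℕ) {s : ℝ} (hs : 0 < s) :
    IsProbabilityMeasure (gaussianRef n s) := by
  constructor
  rw [gaussianRef, Measure.smul_apply, withDensity_apply _ MeasurableSet.univ,
    Measure.restrict_univ, lintegral_exp_neg_gaussianCost n hs, smul_eq_mul, ← mul_pow,
    ENNReal.inv_mul_cancel (by simpa using Real.pi_pos) ENNReal.ofReal_ne_top, one_pow]

/-- Change of measure from the noise around `a` to the Gaussian reference measure. -/
theorem lintegral_receiverNoise_tilt_le {n : ℕ} (s : ℝ) (a : Signal n) {g : Signal n → ℝ≥0∞}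
    (hg : Measurable g) :
    ∫⁻ z, ENNReal.ofReal (Real.exp (-gaussianCost s (z + a))) * g (z + a) ∂receiverNoise n ≤
      ∫⁻ y, g y ∂gaussianRef n s := by
  -- Once the noise is bounded by Lebesgue measure, translation invariance removes the shift `a`, so
  -- the reference measure does not depend on the files.
  refine (lintegral_mono' (receiverNoise_le_volume n) le_rfl).trans (le_of_eq ?_)
  rw [lintegral_smul_measure, gaussianRef, lintegral_smul_measure,
    lintegral_withDensity_eq_lintegral_mul _ (by fun_prop) hg]
  congr 1
  exact lintegral_add_right_eq_self
    (fun y => ENNReal.ofReal (Real.exp (-gaussianCost s y)) * g y) a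

/-- The second moment of the noise. -/
theorem lintegral_sq_gaussianReal (v : ℝ≥0) :
    ∫⁻ x, ENNReal.ofReal (x ^ 2) ∂gaussianReal 0 v = ENNReal.ofReal v := by
  have hm : MemLp id 2 (gaussianReal 0 v) := memLp_id_gaussianReal 2
  have h := variance_eq_integral (μ := gaussianReal 0 v) (X := id) aemeasurable_id
  rw [variance_id_gaussianReal] at h
  rw [h, ← ofReal_integral_eq_lintegral_ofReal (f := fun x : ℝ => x ^ 2) hm.integrable_sq
    (ae_of_all _ fun x => sq_nonneg x)]
  simp

theorem lintegral_sq_norm_complexGaussian :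
    ∫⁻ z, ENNReal.ofReal (‖z‖ ^ 2) ∂complexGaussian = 1 := by
  have hf : Measurable fun p : ℝ × ℝ => (⟨p.1, p.2⟩ : ℂ) :=
    Complex.measurableEquivRealProd.symm.measurable
  rw [complexGaussian, lintegral_map (by fun_prop) hf]
  have : ∀ p : ℝ × ℝ, ENNReal.ofReal (‖(⟨p.1, p.2⟩ : ℂ)‖ ^ 2) =
      ENNReal.ofReal (p.1 ^ 2) + ENNReal.ofReal (p.2 ^ 2) := fun p => by
    rw [← ENNReal.ofReal_add (sq_nonneg _) (sq_nonneg _), Complex.sq_norm, Complex.normSq_mk]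
    congr 1; ring
  simp_rw [this]
  rw [lintegral_add_left (by fun_prop), lintegral_prod _ (by fun_prop),
    lintegral_prod _ (by fun_prop)]
  simp only [lintegral_const, measure_univ, mul_one, lintegral_sq_gaussianReal]
  rw [← ENNReal.ofReal_add (by positivity) (by positivity)]
  norm_num

theorem lintegral_energy_receiverNoise (n : ℕ) :
    ∫⁻ z, ENNReal.ofReal (energy z) ∂receiverNoise n = n := by
  have : ∀ z : Signal n, ENNReal.ofReal (energy z) = ∑ t, ENNReal.ofReal (‖z t‖ ^ 2) := fun z =>
    ENNReal.ofReal_sum_of_nonneg fun _ _ => sq_nonneg _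
  simp_rw [this]
  rw [lintegral_finsetSum _ (fun t _ => by fun_prop)]
  have h : ∀ t : Fin n, ∫⁻ z, ENNReal.ofReal (‖z t‖ ^ 2) ∂receiverNoise n = 1 := fun t => by
    rw [receiverNoise, ← lintegral_sq_norm_complexGaussian]
    exact (measurePreserving_eval (fun _ : Fin n => complexGaussian) t).lintegral_comp
      (f := fun z : ℂ => ENNReal.ofReal (‖z‖ ^ 2)) (by fun_prop)
  simp only [h, Finset.sum_const, Finset.card_univ, Fintype.card_fin, nsmul_eq_mul, mul_one]

theorem lintegral_noiseLaw {n : ℕ} {k l : Fin 2} (hkl : k ≠ l) {f : Signal n → Signal n → ℝ≥0∞}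
    (hf : Measurable (Function.uncurry f)) :
    ∫⁻ z, f (z k) (z l) ∂noiseLaw n =
      ∫⁻ z₁, ∫⁻ z₂, f z₁ z₂ ∂receiverNoise n ∂receiverNoise n := by
  have h := measurePreserving_finTwoArrow (receiverNoise n)
  have h01 : ∀ g : Signal n → Signal n → ℝ≥0∞, Measurable (Function.uncurry g) →
      ∫⁻ z, g (z 0) (z 1) ∂noiseLaw n =
        ∫⁻ z₁, ∫⁻ z₂, g z₁ z₂ ∂receiverNoise n ∂receiverNoise n := fun g hg => by
    rw [lintegral_lintegral hg.aemeasurable]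
    exact h.lintegral_comp (f := fun p => g p.1 p.2) hg
  have hc : (k = 0 ∧ l = 1) ∨ (k = 1 ∧ l = 0) := by omega
  rcases hc with ⟨rfl, rfl⟩ | ⟨rfl, rfl⟩
  · exact h01 f hf
  · rw [lintegral_lintegral_swap hf.aemeasurable]
    exact h01 (fun a b => f b a) (hf.comp measurable_swap)

theorem lintegral_noiseLaw_eval {n : ℕ} (k : Fin 2) {f : Signal n → ℝ≥0∞} (hf : Measurable f) :
    ∫⁻ z, f (z k) ∂noiseLaw n = ∫⁻ z, f z ∂receiverNoise n :=
  (measurePreserving_eval (fun _ : Fin 2 => receiverNoise n) k).lintegral_comp hf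

/-! ### A Fano-type inequality with discrete side information -/

section SideInformation

variable {Ω : Type*} [MeasurableSpace Ω]

/-- The probability of the observed value of the random variable `X`. -/
def likelihood (p : Measure Ω) (X : Ω → ℕ) (ω : Ω) : ℝ := p.real (X ⁻¹' {X ω})

variable (p : Measure Ω)

theorem likelihood_nonneg (X : Ω → ℕ) (ω : Ω) : 0 ≤ likelihood p X ω := measureReal_nonneg

theorem likelihood_le_one [IsProbabilityMeasure p] (X : Ω → ℕ) (F : Ω) : likelihood p X F ≤ 1 :=
  measureReal_le_one

theorem likelihood_pos [IsFiniteMeasure p] (hp : ∀ F, 0 < p.real {F}) (Y : Ω → ℕ) (F : Ω) :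
    0 < likelihood p Y F :=
  (hp F).trans_le (measureReal_mono (by simp))

theorem entropy_nonneg [Fintype Ω] [IsProbabilityMeasure p] (X : Ω → ℕ) : 0 ≤ entropy p X :=
  Finset.sum_nonneg fun _ _ => div_nonneg
    (Real.negMulLog_nonneg measureReal_nonneg measureReal_le_one) (Real.log_nonneg one_le_two)

variable [Fintype Ω] [MeasurableSingletonClass Ω]

theorem sum_image_measureReal_preimage [IsProbabilityMeasure p] (X : Ω → ℕ) :
    ∑ a ∈ Finset.univ.image X, p.real (X ⁻¹' {a}) = 1 := by
  rw [← measureReal_biUnion_finset _ fun _ _ => Set.Finite.measurableSet (Set.toFinite _)]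
  · have : ⋃ b ∈ Finset.univ.image X, X ⁻¹' {b} = Set.univ := by
      ext ω; simp
    rw [this, probReal_univ]
  · intro a _ b _ hab
    exact Disjoint.preimage X (by simpa using hab)

/-- If the values of the `V i` together with `rest` identify the elements of `C`, then the
product likelihoods on `C` sum to at most the number of values of `rest`. -/
theorem sum_indicator_prod_likelihood_le [IsProbabilityMeasure p] {ι R : Type*} [Fintype ι]
    [Fintype R] (C : Set Ω) (V : ι → Ω → ℕ) (rest : Ω → R)
    (inj : ∀ F ∈ C, ∀ F' ∈ C, rest F = rest F' → (∀ i, V i F = V i F') → F = F') :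
    ∑ F, C.indicator (fun F => ∏ i, likelihood p (V i) F) F ≤ Fintype.card R := by
  classical
  let Φ : Ω → R × (ι → ℕ) := fun F => (rest F, fun i => V i F)
  let q : R × (ι → ℕ) → ℝ := fun x => ∏ i, p.real (V i ⁻¹' {x.2 i})
  let T : Finset (R × (ι → ℕ)) :=
    Finset.univ ×ˢ Fintype.piFinset fun i => Finset.univ.image (V i)
  calc ∑ F, C.indicator (fun F => ∏ i, likelihood p (V i) F) F
      = ∑ F ∈ Finset.univ.filter (· ∈ C), q (Φ F) := by
        rw [Finset.sum_filter]; rfl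
    _ = ∑ x ∈ (Finset.univ.filter (· ∈ C)).image Φ, q x := by
        rw [Finset.sum_image]
        intro F hF F' hF' h
        exact inj F (by simpa using hF) F' (by simpa using hF') (congrArg Prod.fst h)
          fun i => congrFun (congrArg Prod.snd h) i
    _ ≤ ∑ x ∈ T, q x := by
        refine Finset.sum_le_sum_of_subset_of_nonneg ?_ fun _ _ _ =>
          Finset.prod_nonneg fun _ _ => measureReal_nonneg
        intro x hx
        obtain ⟨F, -, rfl⟩ := Finset.mem_image.1 hx
        simp [T, Φ, Fintype.mem_piFinset]
    -- The sum over all label tuples factorizes into total masses of the laws of the `V i`, each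
    -- equal to 1. The coordinates need not be independent under `p`.
    _ = Fintype.card R := by
        rw [Finset.sum_product]
        have : ∑ v ∈ Fintype.piFinset fun i => Finset.univ.image (V i),
            ∏ i, p.real (V i ⁻¹' {v i}) = 1 := by
          rw [← Finset.prod_univ_sum (fun i => Finset.univ.image (V i))
            fun i a => p.real (V i ⁻¹' {a})]
          exact Finset.prod_eq_one fun i _ => sum_image_measureReal_preimage p (V i)
        simp only [q, this]
        simp

theorem lintegral_uniformOn [Nonempty Ω] (f : Ω → ℝ≥0∞) :
    ∫⁻ F, f F ∂uniformOn Set.univ = (∑ F, f F) / Fintype.card Ω := by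
  rw [lintegral_fintype, ENNReal.div_eq_inv_mul, Finset.mul_sum]
  refine Finset.sum_congr rfl fun F _ => ?_
  rw [uniformOn_univ, Measure.count_singleton, mul_comm, one_div]

/-- This is the success probability of the independent guesses, averaged over a uniform message,
with `rest` revealed for free. -/
theorem lintegral_indicator_prod_likelihood_le [Nonempty Ω] {ι R : Type*} [Fintype ι]
    [Fintype R] (C : Set Ω) (V : ι → Ω → ℕ) (rest : Ω → R)
    (inj : ∀ F ∈ C, ∀ F' ∈ C, rest F = rest F' → (∀ i, V i F = V i F') → F = F') :
    ∫⁻ F, C.indicator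
        (fun F => ENNReal.ofReal (∏ i, likelihood (uniformOn Set.univ) (V i) F)) F
        ∂uniformOn Set.univ ≤ ENNReal.ofReal (Fintype.card R / Fintype.card Ω) := by
  have h := sum_indicator_prod_likelihood_le (uniformOn Set.univ) C V rest inj
  have hind : ∀ F, C.indicator
      (fun F => ENNReal.ofReal (∏ i, likelihood (uniformOn Set.univ) (V i) F)) F =
      ENNReal.ofReal (C.indicator (fun F => ∏ i, likelihood (uniformOn Set.univ) (V i) F) F) :=
    fun F => by by_cases hF : F ∈ C <;> simp [hF]
  have hpos : (0 : ℝ) < Fintype.card Ω := by exact_mod_cast Fintype.card_pos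
  simp_rw [hind]
  rw [lintegral_uniformOn, ← ENNReal.ofReal_sum_of_nonneg fun F _ =>
    Set.indicator_nonneg (fun F _ => Finset.prod_nonneg fun i _ => likelihood_nonneg _ _ _) F,
    ENNReal.ofReal_div_of_pos hpos, ENNReal.ofReal_natCast]
  refine ENNReal.div_le_div ((ENNReal.ofReal_le_ofReal h).trans_eq ?_) (by simp)
  exact ENNReal.ofReal_natCast _

theorem sum_neg_log_likelihood [IsProbabilityMeasure p] (X : Ω → ℕ) :
    ∑ F, p.real {F} * -Real.log (likelihood p X F) = entropy p X * Real.log 2 := by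
  have hl : Real.log 2 ≠ 0 := (Real.log_pos one_lt_two).ne'
  rw [entropy, ← Finset.sum_div, div_mul_cancel₀ _ hl]
  rw [← Finset.sum_fiberwise_of_maps_to (t := Finset.univ.image X) (g := X)
    (fun F _ => Finset.mem_image_of_mem X (Finset.mem_univ F))]
  refine Finset.sum_congr rfl fun a _ => ?_
  have : ∀ F ∈ Finset.univ.filter (X · = a), p.real {F} * -Real.log (likelihood p X F) =
      p.real {F} * -Real.log (p.real (X ⁻¹' {a})) := fun F hF => by
    rw [likelihood, (Finset.mem_filter.1 hF).2]
  rw [Finset.sum_congr rfl this, ← Finset.sum_mul, sum_measureReal_singleton, Real.negMulLog]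
  have hs : ((Finset.univ.filter (X · = a) : Finset Ω) : Set Ω) = X ⁻¹' {a} := by
    ext; simp
  rw [hs]; ring

theorem lintegral_neg_log_likelihood [IsProbabilityMeasure p] (X : Ω → ℕ) :
    ∫⁻ F, ENNReal.ofReal (-Real.log (likelihood p X F)) ∂p =
      ENNReal.ofReal (entropy p X * Real.log 2) := by
  have h0 : ∀ F, 0 ≤ -Real.log (likelihood p X F) := fun F =>
    neg_nonneg.2 (Real.log_nonpos (likelihood_nonneg _ _ _) (likelihood_le_one p X F))
  rw [lintegral_fintype, ← sum_neg_log_likelihood, ENNReal.ofReal_sum_of_nonneg fun F _ =>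
    mul_nonneg measureReal_nonneg (h0 F)]
  refine Finset.sum_congr rfl fun F _ => ?_
  rw [ENNReal.ofReal_mul measureReal_nonneg, ofReal_measureReal, mul_comm]

variable {X : Type*} [MeasurableSpace X]

theorem measurable_likelihood [IsFiniteMeasure p] {V : Ω → X → ℕ} (hV : ∀ F, Measurable (V F))
    (F : Ω) : Measurable fun x => likelihood p (fun F' => V F' x) F := by
  classical
  have : ∀ x, likelihood p (fun F' => V F' x) F =
      ∑ F', {x | V F' x = V F x}.indicator (fun _ => p.real {F'}) x := fun x => by
    have hs : ((Finset.univ.filter (fun F' => V F' x = V F x) : Finset Ω) : Set Ω) =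
        (fun F' => V F' x) ⁻¹' {V F x} := by
      ext; simp
    rw [likelihood, ← hs, ← sum_measureReal_singleton, Finset.sum_filter]
    simp [Set.indicator_apply]
  simp_rw [this]
  exact Finset.measurable_sum _ fun F' _ =>
    measurable_const.indicator (measurableSet_eq_fun (hV F') (hV F))

theorem measurable_entropy [IsProbabilityMeasure p] {V : Ω → X → ℕ} (hV : ∀ F, Measurable (V F)) :
    Measurable fun x => entropy p (fun F => V F x) := by
  have hl : Real.log 2 ≠ 0 := (Real.log_pos one_lt_two).ne'
  have : ∀ x, entropy p (fun F => V F x) =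
      (∑ F, p.real {F} * -Real.log (likelihood p (fun F' => V F' x) F)) / Real.log 2 := fun x => by
    rw [sum_neg_log_likelihood, mul_div_cancel_right₀ _ hl]
  simp_rw [this]
  exact (Finset.measurable_sum _ fun F _ =>
    ((Real.measurable_log.comp (measurable_likelihood p hV F)).neg.const_mul _)).div_const _

/-- The event that `Y` takes its observed value contains the outcome itself. The resulting bound
does not depend on `Y`, which makes the entropy of a fronthaul message integrable over the channel.
-/
theorem entropy_mul_log_two_le [IsProbabilityMeasure p] (hp : ∀ F, 0 < p.real {F}) (Y : Ω → ℕ) :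
    entropy p Y * Real.log 2 ≤ ∑ F, p.real {F} * -Real.log (p.real {F}) := by
  rw [← sum_neg_log_likelihood]
  gcongr with F
  · exact hp F
  · exact measureReal_mono (by simp)

/-- If guessing the side information `V` according to its law identifies the message with
likelihood ratio at most `1 / M`, then the mass of the correct decisions is controlled by the
cost and by the entropies of the side information. -/
theorem lintegral_correct_mul_log_le [IsProbabilityMeasure p] {ι : Type*} [Fintype ι]
    (hp : ∀ F, 0 < p.real {F}) (κ : Measure X) [IsProbabilityMeasure κ] {C : Ω → Set X}
    (hC : ∀ F, MeasurableSet (C F)) {V : ι → Ω → X → ℕ} (hV : ∀ i F, Measurable (V i F))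
    {cost : Ω → X → ℝ} (hcost : ∀ F, Measurable (cost F)) {M : ℝ} (hM : 0 < M)
    (h : ∫⁻ x, ∫⁻ F, (C F).indicator (fun x => ENNReal.ofReal
        (Real.exp (-cost F x) * ∏ i, likelihood p (fun F' => V i F' x) F)) x ∂p ∂κ ≤
      ENNReal.ofReal M⁻¹) :
    (∫⁻ F, κ (C F) ∂p) * ENNReal.ofReal (Real.log M) ≤
      1 + ∫⁻ F, ∫⁻ x in C F, ENNReal.ofReal (cost F x) ∂κ ∂p +
        ∑ i, ∫⁻ x, ENNReal.ofReal (entropy p (fun F => V i F x) * Real.log 2) ∂κ := by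
  have hlik : ∀ i F, Measurable fun x => likelihood p (fun F' => V i F' x) F := fun i F =>
    measurable_likelihood p (hV i) F
  have hmeas : Measurable fun z : Ω × X => (C z.1).indicator (fun x => ENNReal.ofReal
        (Real.exp (-cost z.1 x) * ∏ i, likelihood p (fun F' => V i F' x) z.1)) z.2 := by
    refine measurable_from_prod_countable_right fun F => ?_
    refine Measurable.indicator ?_ (hC F)
    exact ENNReal.measurable_ofReal.comp
      ((Real.measurable_exp.comp (hcost F).neg).mul (Finset.measurable_prod _ fun i _ => hlik i F))
  have hmeas' : ∀ F, Measurable fun x => (C F).indicator (fun x => ENNReal.ofReal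
        (Real.exp (-cost F x) * ∏ i, likelihood p (fun F' => V i F' x) F)) x :=
    fun F => hmeas.comp measurable_prodMk_left
  have hlog : ∀ i F, Measurable fun x =>
      ENNReal.ofReal (-Real.log (likelihood p (fun F' => V i F' x) F)) := fun i F =>
    ENNReal.measurable_ofReal.comp (Real.measurable_log.comp (hlik i F)).neg
  have hent : ∀ i, ∫⁻ F, ∫⁻ x,
      ENNReal.ofReal (-Real.log (likelihood p (fun F' => V i F' x) F)) ∂κ ∂p =
      ∫⁻ x, ENNReal.ofReal (entropy p (fun F => V i F x) * Real.log 2) ∂κ := fun i => by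
    rw [lintegral_lintegral_swap]
    · simp_rw [lintegral_neg_log_likelihood]
    · exact (measurable_from_prod_countable_right fun F => hlog i F).aemeasurable
  have hpt : ∀ F x, (C F).indicator (fun _ => ENNReal.ofReal (Real.log M)) x ≤
      ENNReal.ofReal M * (C F).indicator (fun x => ENNReal.ofReal
        (Real.exp (-cost F x) * ∏ i, likelihood p (fun F' => V i F' x) F)) x +
      ((C F).indicator (fun x => ENNReal.ofReal (cost F x)) x +
      ∑ i, ENNReal.ofReal (-Real.log (likelihood p (fun F' => V i F' x) F))) := fun F x => by
    by_cases hx : x ∈ C F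
    · simp only [hx, Set.indicator_of_mem]
      set P := ∏ i, likelihood p (fun F' => V i F' x) F with hP
      have hPpos : 0 < P := Finset.prod_pos fun i _ => likelihood_pos p hp _ _
      have h0 : ∀ i ∈ (Finset.univ : Finset ι),
          0 ≤ -Real.log (likelihood p (fun F' => V i F' x) F) := fun i _ =>
        neg_nonneg.2 (Real.log_nonpos (likelihood_nonneg _ _ _) (likelihood_le_one p _ F))
      have hlogP : ∑ i, -Real.log (likelihood p (fun F' => V i F' x) F) = -Real.log P := by
        rw [hP, Real.log_prod fun i _ => (likelihood_pos p hp _ _).ne', Finset.sum_neg_distrib]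
      rw [← ENNReal.ofReal_sum_of_nonneg h0, hlogP, ← ENNReal.ofReal_mul hM.le]
      -- This is `log t ≤ t - 1 ≤ t` at `t = M * exp (-cost) * P`, with the logarithm expanded.
      have hle : Real.log M ≤ M * (Real.exp (-cost F x) * P) + (cost F x + -Real.log P) := by
        have h1 : Real.log (M * (Real.exp (-cost F x) * P)) ≤ M * (Real.exp (-cost F x) * P) :=
          (Real.log_le_sub_one_of_pos (by positivity)).trans (by linarith)
        rw [Real.log_mul hM.ne' (by positivity), Real.log_mul (Real.exp_pos _).ne' hPpos.ne',
          Real.log_exp] at h1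
        linarith
      refine (ENNReal.ofReal_le_ofReal hle).trans (ENNReal.ofReal_add_le.trans ?_)
      gcongr
      exact ENNReal.ofReal_add_le
    · simp [hx]
  calc (∫⁻ F, κ (C F) ∂p) * ENNReal.ofReal (Real.log M)
      = ∫⁻ F, ∫⁻ x, (C F).indicator (fun _ => ENNReal.ofReal (Real.log M)) x ∂κ ∂p := by
        rw [← lintegral_mul_const _ .of_discrete]
        refine lintegral_congr fun F => ?_
        rw [lintegral_indicator_const (hC F), mul_comm]
    _ ≤ ∫⁻ F, ∫⁻ x, (ENNReal.ofReal M * (C F).indicator (fun x => ENNReal.ofReal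
          (Real.exp (-cost F x) * ∏ i, likelihood p (fun F' => V i F' x) F)) x +
        ((C F).indicator (fun x => ENNReal.ofReal (cost F x)) x +
        ∑ i, ENNReal.ofReal (-Real.log (likelihood p (fun F' => V i F' x) F)))) ∂κ ∂p :=
        lintegral_mono fun F => lintegral_mono fun x => hpt F x
    _ = ENNReal.ofReal M * (∫⁻ F, ∫⁻ x, (C F).indicator (fun x => ENNReal.ofReal
          (Real.exp (-cost F x) * ∏ i, likelihood p (fun F' => V i F' x) F)) x ∂κ ∂p) +
        (∫⁻ F, ∫⁻ x in C F, ENNReal.ofReal (cost F x) ∂κ ∂p +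
        ∑ i, ∫⁻ F, ∫⁻ x,
          ENNReal.ofReal (-Real.log (likelihood p (fun F' => V i F' x) F)) ∂κ ∂p) := by
        rw [← lintegral_const_mul _ .of_discrete, ← lintegral_finsetSum _ fun _ _ => .of_discrete,
          ← lintegral_add_left .of_discrete, ← lintegral_add_left .of_discrete]
        refine lintegral_congr fun F => ?_
        rw [lintegral_add_left ((hmeas' F).const_mul _), lintegral_const_mul _ (hmeas' F),
          lintegral_add_left (Measurable.indicator (by fun_prop) (hC F)),
          lintegral_indicator (hC F) (fun x => ENNReal.ofReal (cost F x)),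
          lintegral_finsetSum _ fun i _ => hlog i F]
    _ ≤ ENNReal.ofReal M * ENNReal.ofReal M⁻¹ +
        (∫⁻ F, ∫⁻ x in C F, ENNReal.ofReal (cost F x) ∂κ ∂p +
        ∑ i, ∫⁻ x, ENNReal.ofReal (entropy p (fun F => V i F x) * Real.log 2) ∂κ) := by
        simp_rw [hent]
        gcongr
        rw [lintegral_lintegral_swap hmeas.aemeasurable]
        exact h
    _ = _ := by
        rw [← ENNReal.ofReal_mul hM.le, mul_inv_cancel₀ hM.ne', ENNReal.ofReal_one, add_assoc]

end SideInformation

/-! ### Energy and change of measure for two receivers -/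

theorem energy_add_le {n : ℕ} (x y : Signal n) : energy (x + y) ≤ 2 * (energy x + energy y) := by
  rw [energy, energy, energy, ← Finset.sum_add_distrib, Finset.mul_sum]
  refine Finset.sum_le_sum fun t _ => ?_
  have := norm_add_le (x t) (y t)
  have h : ‖(x + y) t‖ ^ 2 ≤ (‖x t‖ + ‖y t‖) ^ 2 := by
    gcongr; exact this
  nlinarith [sq_nonneg (‖x t‖ - ‖y t‖)]

theorem energy_smul {n : ℕ} (c : ℂ) (x : Signal n) : energy (c • x) = ‖c‖ ^ 2 * energy x := by
  simp [energy, Finset.mul_sum, mul_pow]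

theorem lintegral_tilt_one_user_le {n : ℕ} (k : Fin 2) (P : ℝ) (a : Signal n) {A : Set (Signal n)}
    (hA : MeasurableSet A) :
    ∫⁻ z, {z : Fin 2 → Signal n | z k + a ∈ A}.indicator
        (fun z => ENNReal.ofReal (Real.exp (-gaussianCost P (z k + a)))) z ∂noiseLaw n ≤
      gaussianRef n P A := by
  rw [← lintegral_indicator_one hA]
  refine le_trans (le_of_eq ?_)
    (lintegral_receiverNoise_tilt_le P a (g := A.indicator 1) (measurable_one.indicator hA))
  rw [← lintegral_noiseLaw_eval k
    (f := fun z => ENNReal.ofReal (Real.exp (-gaussianCost P (z + a))) * A.indicator 1 (z + a))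
    (by
      have hA1 : Measurable (A.indicator (1 : Signal n → ℝ≥0∞)) := measurable_one.indicator hA
      fun_prop)]
  refine lintegral_congr fun z => ?_
  by_cases h : z k + a ∈ A <;> simp [h]

/-- The pair of outputs is described by the output `y` of user `k` and the residual noise `e = z_l -
ρ z_k`: the output of user `l` equals `e + ρ y + (b - ρ a)`. The change of measure is applied first
to `z_l` for fixed `z_k`, then to `z_k`, and makes `e` and `y` independent Gaussians. The files
enter only through the decision sets and `b - ρ a`. -/
theorem lintegral_tilt_two_users_le {n : ℕ} {k l : Fin 2} (hkl : k ≠ l) (P : ℝ) (ρ : ℂ)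
    (a b : Signal n) {A B : Set (Signal n)} (hA : MeasurableSet A) (hB : MeasurableSet B) :
    ∫⁻ z, {z : Fin 2 → Signal n | z k + a ∈ A ∧ z l + b ∈ B}.indicator
        (fun z => ENNReal.ofReal
          (Real.exp (-(gaussianCost P (z k + a) + gaussianCost 1 (z l - ρ • z k))))) z ∂noiseLaw n ≤
      (gaussianRef n P).prod (gaussianRef n 1)
        {q | q.1 ∈ A ∧ q.2 + (ρ • q.1 + (b - ρ • a)) ∈ B} := by
  have := isProbabilityMeasure_gaussianRef n one_pos
  have hA1 : Measurable (A.indicator (1 : Signal n → ℝ≥0∞)) := measurable_one.indicator hA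
  have hB1 : Measurable (B.indicator (1 : Signal n → ℝ≥0∞)) := measurable_one.indicator hB
  have hG : Measurable fun y : Signal n =>
      ∫⁻ e, B.indicator 1 (e + (ρ • y + (b - ρ • a))) ∂gaussianRef n 1 :=
    Measurable.lintegral_prod_right' (f := fun p : Signal n × Signal n =>
      B.indicator (1 : Signal n → ℝ≥0∞) (p.2 + (ρ • p.1 + (b - ρ • a)))) (by fun_prop)
  calc _ = ∫⁻ z, ENNReal.ofReal (Real.exp (-gaussianCost P (z k + a))) * A.indicator 1 (z k + a) *
          (ENNReal.ofReal (Real.exp (-gaussianCost 1 (z l + -(ρ • z k)))) *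
            B.indicator 1 (z l + b)) ∂noiseLaw n := by
        refine lintegral_congr fun z => ?_
        by_cases h : z k + a ∈ A <;> by_cases h' : z l + b ∈ B
        · simp [h, h', Real.exp_add, ENNReal.ofReal_mul (Real.exp_pos _).le,
            sub_eq_add_neg, mul_comm]
        all_goals simp [h, h']
    _ = ∫⁻ z₁, ∫⁻ z₂, ENNReal.ofReal (Real.exp (-gaussianCost P (z₁ + a))) *
          A.indicator 1 (z₁ + a) * (ENNReal.ofReal (Real.exp (-gaussianCost 1 (z₂ + -(ρ • z₁)))) *
            B.indicator 1 (z₂ + b)) ∂receiverNoise n ∂receiverNoise n := by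
        exact lintegral_noiseLaw hkl (f := fun z₁ z₂ =>
          ENNReal.ofReal (Real.exp (-gaussianCost P (z₁ + a))) *
          A.indicator 1 (z₁ + a) * (ENNReal.ofReal (Real.exp (-gaussianCost 1 (z₂ + -(ρ • z₁)))) *
            B.indicator 1 (z₂ + b))) (by unfold Function.uncurry; fun_prop)
    _ = ∫⁻ z₁, ENNReal.ofReal (Real.exp (-gaussianCost P (z₁ + a))) *
          A.indicator 1 (z₁ + a) *
          ∫⁻ z₂, ENNReal.ofReal (Real.exp (-gaussianCost 1 (z₂ + -(ρ • z₁)))) *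
            B.indicator 1 (z₂ + b) ∂receiverNoise n ∂receiverNoise n := by
        refine lintegral_congr fun z₁ => lintegral_const_mul _ (by fun_prop)
    _ ≤ ∫⁻ z₁, ENNReal.ofReal (Real.exp (-gaussianCost P (z₁ + a))) *
          A.indicator 1 (z₁ + a) *
          ∫⁻ e, B.indicator 1 (e + (ρ • (z₁ + a) + (b - ρ • a))) ∂gaussianRef n 1
            ∂receiverNoise n := by
        refine lintegral_mono fun z₁ => mul_le_mul' le_rfl ?_
        refine le_trans (le_of_eq ?_) (lintegral_receiverNoise_tilt_le 1 (-(ρ • z₁))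
          (g := fun e => B.indicator 1 (e + (ρ • (z₁ + a) + (b - ρ • a)))) (by fun_prop))
        refine lintegral_congr fun z₂ => ?_
        congr 2
        rw [smul_add]; abel
    _ ≤ ∫⁻ y, A.indicator 1 y *
          ∫⁻ e, B.indicator 1 (e + (ρ • y + (b - ρ • a))) ∂gaussianRef n 1 ∂gaussianRef n P := by
        simp_rw [mul_assoc]
        exact lintegral_receiverNoise_tilt_le P a (hA1.mul hG)
    _ = _ := by
        have hS : MeasurableSet {q : Signal n × Signal n |
            q.1 ∈ A ∧ q.2 + (ρ • q.1 + (b - ρ • a)) ∈ B} :=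
          (measurable_fst hA).inter (Measurable.comp (g := fun q : Signal n × Signal n =>
            q.2 + (ρ • q.1 + (b - ρ • a))) (by fun_prop) measurable_id hB)
        rw [Measure.prod_apply hS]
        refine lintegral_congr fun y => ?_
        rw [← lintegral_const_mul _ (by fun_prop),
          ← lintegral_indicator_one (measurable_prodMk_left hS)]
        refine lintegral_congr fun e => ?_
        by_cases h : y ∈ A <;> by_cases h' : e + (ρ • y + (b - ρ • a)) ∈ B <;> simp [h, h']

/-! ### Finite blocklength bounds -/

instance (J L : ℕ) : IsProbabilityMeasure (libraryLaw J L) := by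
  unfold libraryLaw; infer_instance

instance (ν : Measure ℂ) [IsProbabilityMeasure ν] : IsProbabilityMeasure (csiLaw ν) := by
  unfold csiLaw; infer_instance

theorem libraryLaw_real_singleton_pos {J L : ℕ} (F : Library J L) :
    0 < (libraryLaw J L).real {F} := by
  rw [libraryLaw, measureReal_def, uniformOn_univ, Measure.count_singleton, one_div,
    ENNReal.toReal_inv, ENNReal.toReal_natCast, inv_pos, Nat.cast_pos]
  exact Fintype.card_pos

theorem card_rest_div_card_library {J L : ℕ} (I : Finset (Fin J)) :
    (Fintype.card ({j // j ∉ I} → File L) : ℝ) / Fintype.card (Library J L) =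
      ((2 : ℝ) ^ (L * I.card))⁻¹ := by
  have h : I.card ≤ J := by simpa using Finset.card_le_univ I
  have hc : Fintype.card {j // j ∉ I} = J - I.card := by
    rw [Fintype.card_subtype_compl]; simp
  rw [Fintype.card_fun, Fintype.card_fun, hc]
  simp only [Fintype.card_fun, Fintype.card_bool, Fintype.card_fin]
  push_cast
  rw [← pow_mul, ← pow_mul, div_eq_iff (by positivity), inv_mul_eq_div, eq_div_iff (by positivity),
    ← pow_add, ← Nat.mul_add, Nat.sub_add_cancel h]

namespace Policy

variable {J L : ℕ} (π : Policy J L) (D : Demand J)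

theorem measurable_codeword (m : Fin 2) (F : Library J L) : Measurable (π.codeword m D F) := by
  have h : Measurable fun p : ℕ × CSI => π.edge m D (fun j => π.cache m j (F j)) p.1 p.2 :=
    measurable_from_prod_countable_right fun u => π.measurable_edge m D _ u
  exact h.comp ((π.measurable_fronthaul m D F).prodMk measurable_id)

/-- The received signal without noise. -/
def noiseless (k : Fin 2) (F : Library J L) (h : CSI) : Signal (π.edgeTime D) :=
  ∑ m, h m k • π.codeword m D F h

theorem received_eq (k : Fin 2) (F : Library J L) (h : CSI) (z : Fin 2 → Signal (π.edgeTime D)) :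
    π.received k D F h z = z k + π.noiseless D k F h := by
  funext t
  simp [received, noiseless, add_comm]

@[fun_prop]
theorem measurable_noiseless (k : Fin 2) (F : Library J L) : Measurable (π.noiseless D k F) := by
  have := fun m => π.measurable_codeword D m F
  unfold noiseless
  fun_prop

/-- The signals that user `k` decodes as `w`. -/
def decisionRegion (k : Fin 2) (h : CSI) (w : File L) : Set (Signal (π.edgeTime D)) :=
  {y | π.decode k D y h = w}

theorem measurableSet_decisionRegion (k : Fin 2) (h : CSI) (w : File L) :
    MeasurableSet (π.decisionRegion D k h w) :=
  ((π.measurable_decode k D).comp measurable_prodMk_right) (measurableSet_singleton w)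

/-- The channel states and noises for which user `k` decodes its file. -/
def correctSet (k : Fin 2) (F : Library J L) : Set (CSI × (Fin 2 → Signal (π.edgeTime D))) :=
  {x | x.2 k + π.noiseless D k F x.1 ∈ π.decisionRegion D k x.1 (F (D k))}

theorem measurableSet_correctSet (k : Fin 2) (F : Library J L) :
    MeasurableSet (π.correctSet D k F) := by
  have h : Measurable fun x : CSI × (Fin 2 → Signal (π.edgeTime D)) =>
      (x.2 k + π.noiseless D k F x.1, x.1) := by fun_prop
  exact ((π.measurable_decode k D).comp h) (measurableSet_singleton (F (D k)))

/-- The channel states in `G` and the noises for which all users in `A` decode their files. -/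
def goodSet (A : Finset (Fin 2)) (G : Set CSI) (F : Library J L) :
    Set (CSI × (Fin 2 → Signal (π.edgeTime D))) :=
  {x | x.1 ∈ G ∧ ∀ k ∈ A, x ∈ π.correctSet D k F}

theorem measurableSet_goodSet (A : Finset (Fin 2)) {G : Set CSI} (hG : MeasurableSet G)
    (F : Library J L) : MeasurableSet (π.goodSet D A G F) := by
  have : π.goodSet D A G F = Prod.fst ⁻¹' G ∩ ⋂ k ∈ A, π.correctSet D k F := by
    ext; simp [goodSet]
  rw [this]
  exact (measurable_fst hG).inter
    (Finset.measurableSet_biInter A fun k _ => π.measurableSet_correctSet D k F)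

variable (ν : Measure ℂ)

theorem errorProb_nonneg (k : Fin 2) : 0 ≤ π.errorProb ν D k := measureReal_nonneg

theorem errorProb_le_maxErrorProb (k : Fin 2) : π.errorProb ν D k ≤ π.maxErrorProb ν :=
  (le_ciSup (f := fun k => π.errorProb ν D k) (Set.finite_range _).bddAbove k).trans
    (le_ciSup (f := fun D => ⨆ k, π.errorProb ν D k) (Set.finite_range _).bddAbove D)

variable [IsProbabilityMeasure ν]

/-- The law of the channel state and of the noise. -/
def channelLaw : Measure (CSI × (Fin 2 → Signal (π.edgeTime D))) :=
  (csiLaw ν).prod (noiseLaw (π.edgeTime D))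

instance : IsProbabilityMeasure (π.channelLaw D ν) := by
  unfold channelLaw; infer_instance

theorem ofReal_errorProb (k : Fin 2) :
    ENNReal.ofReal (π.errorProb ν D k) =
      ∫⁻ F, π.channelLaw D ν (π.correctSet D k F)ᶜ ∂libraryLaw J L := by
  have hp : IsProbabilityMeasure (systemLaw J L (π.edgeTime D) ν) := by
    unfold systemLaw; infer_instance
  rw [errorProb, ofReal_measureReal, systemLaw, Measure.prod_apply]
  · refine lintegral_congr fun F => ?_
    rw [channelLaw]
    congr 1
    ext x
    simp [correctSet, decisionRegion, received_eq]
  · have : {ω : Library J L × CSI × (Fin 2 → Signal (π.edgeTime D)) |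
        π.decode k D (π.received k D ω.1 ω.2.1 ω.2.2) ω.2.1 ≠ ω.1 (D k)} =
        ⋃ F, {F} ×ˢ (π.correctSet D k F)ᶜ := by
      ext ω
      simp [correctSet, decisionRegion, received_eq]
    rw [this]
    exact MeasurableSet.iUnion fun F =>
      (measurableSet_singleton F).prod (π.measurableSet_correctSet D k F).compl

/-- Union bound over the users in `A`: a channel state in `G` lies in the good set unless some user
errs. -/
theorem channel_mass_le (A : Finset (Fin 2)) {G : Set CSI} :
    csiLaw ν G ≤ ∫⁻ F, π.channelLaw D ν (π.goodSet D A G F) ∂libraryLaw J L +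
      ENNReal.ofReal (A.card * π.maxErrorProb ν) := by
  have hF : ∀ F, csiLaw ν G ≤ π.channelLaw D ν (π.goodSet D A G F) +
      ∑ k ∈ A, π.channelLaw D ν (π.correctSet D k F)ᶜ := fun F => by
    have h1 : csiLaw ν G = π.channelLaw D ν (G ×ˢ Set.univ) := by
      rw [channelLaw, Measure.prod_prod, measure_univ, mul_one]
    rw [h1]
    refine (measure_mono ?_).trans ((measure_union_le (π.goodSet D A G F)
      (⋃ k ∈ A, (π.correctSet D k F)ᶜ)).trans ?_)
    · intro x hx
      by_cases h : ∀ k ∈ A, x ∈ π.correctSet D k F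
      · exact Or.inl ⟨hx.1, h⟩
      · push Not at h
        obtain ⟨k, hk, hx'⟩ := h
        exact Or.inr (Set.mem_biUnion hk hx')
    · gcongr
      exact measure_biUnion_finset_le _ _
  calc csiLaw ν G = ∫⁻ _, csiLaw ν G ∂libraryLaw J L := by simp
    _ ≤ ∫⁻ F, (π.channelLaw D ν (π.goodSet D A G F) +
      ∑ k ∈ A, π.channelLaw D ν (π.correctSet D k F)ᶜ) ∂libraryLaw J L := lintegral_mono hF
    _ = ∫⁻ F, π.channelLaw D ν (π.goodSet D A G F) ∂libraryLaw J L +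
        ∑ k ∈ A, ENNReal.ofReal (π.errorProb ν D k) := by
      simp_rw [ofReal_errorProb]
      rw [lintegral_add_left .of_discrete, lintegral_finsetSum _ fun _ _ => .of_discrete]
    _ ≤ _ := by
      gcongr
      rw [← ENNReal.ofReal_sum_of_nonneg fun k _ => π.errorProb_nonneg D ν k, ← nsmul_eq_mul]
      exact ENNReal.ofReal_le_ofReal
        (Finset.sum_le_card_nsmul _ _ _ fun k _ => π.errorProb_le_maxErrorProb D ν k)

/-- The converse for the users in `A`, channel states in `G`, side information `V`, and a change
of measure with log-likelihood ratio `cost`. -/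
theorem correct_mul_log_le (A : Finset (Fin 2)) {G : Set CSI} (hG : MeasurableSet G) {ι : Type*}
    [Fintype ι] {V : ι → Library J L → CSI → ℕ} (hV : ∀ i F, Measurable (V i F))
    {cost : Library J L → CSI × (Fin 2 → Signal (π.edgeTime D)) → ℝ}
    (hcost : ∀ F, Measurable (cost F)) {c : ℝ} (hc0 : 0 ≤ c) {b : ι → ℝ} (hb0 : ∀ i, 0 ≤ b i)
    (h : ∀ᵐ g ∂csiLaw ν, ∫⁻ F, ENNReal.ofReal
        (∏ i, likelihood (libraryLaw J L) (fun F' => V i F' g) F) *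
        ∫⁻ z, (π.goodSet D A G F).indicator (fun x => ENNReal.ofReal (Real.exp (-cost F x))) (g, z)
          ∂noiseLaw (π.edgeTime D) ∂libraryLaw J L ≤
      ENNReal.ofReal ((2 : ℝ) ^ (L * A.card))⁻¹)
    (hc : ∫⁻ F, ∫⁻ x in π.goodSet D A G F, ENNReal.ofReal (cost F x) ∂π.channelLaw D ν
      ∂libraryLaw J L ≤ ENNReal.ofReal c)
    (hb : ∀ i, ∫⁻ g, ENNReal.ofReal (entropy (libraryLaw J L) (fun F => V i F g)) ∂csiLaw ν ≤
      ENNReal.ofReal (b i)) :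
    ((csiLaw ν).real G - A.card * π.maxErrorProb ν) * (A.card * (L * Real.log 2)) ≤
      1 + c + (∑ i, b i) * Real.log 2 := by
  have hl : 0 < Real.log 2 := Real.log_pos one_lt_two
  have hlik : ∀ i F, Measurable fun g => likelihood (libraryLaw J L) (fun F' => V i F' g) F :=
    fun i F => measurable_likelihood _ (hV i) F
  have hind : ∀ F, Measurable
      ((π.goodSet D A G F).indicator fun x => ENNReal.ofReal (Real.exp (-cost F x))) := fun F =>
    Measurable.indicator (by have := hcost F; fun_prop) (π.measurableSet_goodSet D A hG F)
  have hmeas : ∀ F, Measurable fun x : CSI × (Fin 2 → Signal (π.edgeTime D)) =>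
      ENNReal.ofReal (∏ i, likelihood (libraryLaw J L) (fun F' => V i F' x.1) F) *
        (π.goodSet D A G F).indicator (fun x => ENNReal.ofReal (Real.exp (-cost F x))) x :=
    fun F => ((Finset.measurable_prod _ fun i _ =>
      (hlik i F).comp measurable_fst).ennreal_ofReal).mul (hind F)
  have hjoint : Measurable fun y : Library J L × (CSI × (Fin 2 → Signal (π.edgeTime D))) =>
      ENNReal.ofReal (∏ i, likelihood (libraryLaw J L) (fun F' => V i F' y.2.1) y.1) *
        (π.goodSet D A G y.1).indicator
          (fun x => ENNReal.ofReal (Real.exp (-cost y.1 x))) y.2 :=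
    measurable_from_prod_countable_right hmeas
  have key := lintegral_correct_mul_log_le (libraryLaw J L) libraryLaw_real_singleton_pos
    (π.channelLaw D ν) (C := π.goodSet D A G) (π.measurableSet_goodSet D A hG)
    (V := fun i F x => V i F x.1) (fun i F => (hV i F).comp measurable_fst) hcost
    (M := 2 ^ (L * A.card)) (by positivity) (by
      have e : ∀ F x, (π.goodSet D A G F).indicator (fun x => ENNReal.ofReal
          (Real.exp (-cost F x) *
            ∏ i, likelihood (libraryLaw J L) (fun F' => V i F' x.1) F)) x =
          ENNReal.ofReal (∏ i, likelihood (libraryLaw J L) (fun F' => V i F' x.1) F) *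
          (π.goodSet D A G F).indicator (fun x => ENNReal.ofReal (Real.exp (-cost F x))) x :=
        fun F x => by
          by_cases hx : x ∈ π.goodSet D A G F <;>
            simp [hx, ENNReal.ofReal_mul (Real.exp_pos _).le, mul_comm]
      simp_rw [e]
      rw [channelLaw, lintegral_prod _ hjoint.lintegral_prod_left'.aemeasurable]
      calc _ ≤ ∫⁻ _, ENNReal.ofReal ((2 : ℝ) ^ (L * A.card))⁻¹ ∂csiLaw ν := by
            refine lintegral_mono_ae (h.mono fun g hg => le_trans (le_of_eq ?_) hg)
            have hsw : AEMeasurable (Function.uncurry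
                fun (z : Fin 2 → Signal (π.edgeTime D)) (F : Library J L) =>
                ENNReal.ofReal (∏ i, likelihood (libraryLaw J L) (fun F' => V i F' g) F) *
                (π.goodSet D A G F).indicator
                  (fun x => ENNReal.ofReal (Real.exp (-cost F x))) (g, z))
                ((noiseLaw (π.edgeTime D)).prod (libraryLaw J L)) :=
              (hjoint.comp
                (f := fun y : (Fin 2 → Signal (π.edgeTime D)) × Library J L => (y.2, g, y.1))
                (by fun_prop)).aemeasurable
            refine (lintegral_lintegral_swap hsw).trans ?_
            refine lintegral_congr fun F => ?_
            exact lintegral_const_mul _ ((hind F).comp measurable_prodMk_left)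
        _ = _ := by simp)
  have hent : ∀ i, ∫⁻ x, ENNReal.ofReal
      (entropy (libraryLaw J L) (fun F => V i F x.1) * Real.log 2) ∂π.channelLaw D ν ≤
      ENNReal.ofReal (b i * Real.log 2) := fun i => by
    simp_rw [ENNReal.ofReal_mul' hl.le]
    have hm : Measurable fun g => entropy (libraryLaw J L) (fun F => V i F g) :=
      measurable_entropy _ (hV i)
    rw [lintegral_mul_const _ (by fun_prop), channelLaw, lintegral_prod _ (by fun_prop)]
    gcongr
    simpa using hb i
  have hM : Real.log (2 ^ (L * A.card)) = A.card * (L * Real.log 2) := by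
    rw [Real.log_pow]; push_cast; ring
  have hM0 : 0 ≤ A.card * (L * Real.log 2) := by positivity
  rw [hM] at key
  have hmass := π.channel_mass_le D ν A (G := G)
  set m := ∫⁻ F, π.channelLaw D ν (π.goodSet D A G F) ∂libraryLaw J L
  -- `m` is the probability of correct decoding with the channel in `G`. It is bounded above through
  -- the cost and the entropies here, and below by `hmass`.
  have htot : m * ENNReal.ofReal (A.card * (L * Real.log 2)) ≤
      ENNReal.ofReal (1 + c + (∑ i, b i) * Real.log 2) := by
    refine key.trans ?_
    have hs : 0 ≤ ∑ i, b i := Finset.sum_nonneg fun i _ => hb0 i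
    rw [ENNReal.ofReal_add (by positivity) (by positivity), ENNReal.ofReal_add one_pos.le hc0,
      ENNReal.ofReal_one, Finset.sum_mul,
      ENNReal.ofReal_sum_of_nonneg fun i _ => mul_nonneg (hb0 i) hl.le]
    gcongr with i
    exact hent i
  have hε : 0 ≤ A.card * π.maxErrorProb ν := by
    have : 0 ≤ π.maxErrorProb ν := measureReal_nonneg.trans (π.errorProb_le_maxErrorProb D ν 0)
    positivity
  have hm1 : m ≤ 1 := by
    refine (lintegral_mono fun F => prob_le_one).trans ?_
    simp
  have hmt : m ≠ ⊤ := ne_top_of_le_ne_top ENNReal.one_ne_top hm1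
  have hreal : (csiLaw ν).real G ≤ m.toReal + A.card * π.maxErrorProb ν := by
    rw [← ENNReal.ofReal_toReal hmt, ← ENNReal.ofReal_add ENNReal.toReal_nonneg hε] at hmass
    exact ENNReal.toReal_le_of_le_ofReal (by positivity) hmass
  rw [← ENNReal.ofReal_toReal hmt, ← ENNReal.ofReal_mul ENNReal.toReal_nonneg] at htot
  have hs : 0 ≤ ∑ i, b i := Finset.sum_nonneg fun i _ => hb0 i
  have htot' := (ENNReal.ofReal_le_ofReal_iff (by positivity)).1 htot
  refine le_trans (mul_le_mul_of_nonneg_right ?_ hM0) htot'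
  linarith

end Policy

/-- Since `Q` does not depend on the files, the integrals can be exchanged and the counting bound
applied for each fixed output `y`. The files outside `I` are revealed for free, which leaves `L *
I.card` unknown bits. -/
theorem lintegral_prod_likelihood_mul_le {J L : ℕ} {Y : Type*} [MeasurableSpace Y] (Q : Measure Y)
    [IsProbabilityMeasure Q] {S : Library J L → Set Y} (hS : ∀ F, MeasurableSet (S F)) {ι : Type*}
    [Fintype ι] (W : ι → Library J L → ℕ) (I : Finset (Fin J))
    (inj : ∀ y F F', y ∈ S F → y ∈ S F' → (∀ j, j ∉ I → F j = F' j) →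
      (∀ i, W i F = W i F') → F = F') :
    ∫⁻ F, ENNReal.ofReal (∏ i, likelihood (libraryLaw J L) (W i) F) * Q (S F) ∂libraryLaw J L ≤
      ENNReal.ofReal ((2 : ℝ) ^ (L * I.card))⁻¹ := by
  have hm : Measurable fun q : Library J L × Y => (S q.1).indicator
      (fun _ => ENNReal.ofReal (∏ i, likelihood (libraryLaw J L) (W i) q.1)) q.2 :=
    measurable_from_prod_countable_right fun F =>
      (measurable_const (a := ENNReal.ofReal
        (∏ i, likelihood (libraryLaw J L) (W i) F))).indicator (hS F)
  calc _ = ∫⁻ F, ∫⁻ y, (S F).indicator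
          (fun _ => ENNReal.ofReal (∏ i, likelihood (libraryLaw J L) (W i) F)) y ∂Q
          ∂libraryLaw J L := by
        refine lintegral_congr fun F => ?_
        rw [lintegral_indicator_const (hS F)]
    _ = ∫⁻ y, ∫⁻ F, (S F).indicator
          (fun _ => ENNReal.ofReal (∏ i, likelihood (libraryLaw J L) (W i) F)) y
          ∂libraryLaw J L ∂Q := lintegral_lintegral_swap hm.aemeasurable
    _ ≤ ∫⁻ _, ENNReal.ofReal ((2 : ℝ) ^ (L * I.card))⁻¹ ∂Q := by
        refine lintegral_mono fun y => ?_
        rw [← card_rest_div_card_library (J := J) (L := L) I]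
        refine le_trans (le_of_eq (lintegral_congr fun F => ?_))
          (lintegral_indicator_prod_likelihood_le {F : Library J L | y ∈ S F} W
            (fun F (j : {j // j ∉ I}) => F j) ?_)
        · by_cases h : y ∈ S F <;> simp [h, libraryLaw]
        · exact fun F hF F' hF' hr hV =>
            inj y F F' hF hF' (fun j hj => congrFun hr ⟨j, hj⟩) hV
    _ = _ := by simp

/-! ### Expected costs and the three finite blocklength converses -/

namespace Policy

variable {J L : ℕ} (π : Policy J L) (D : Demand J) {ν : Measure ℂ}

theorem lintegral_channelLaw_fst {f : CSI → ℝ≥0∞} (hf : Measurable f) :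
    ∫⁻ x, f x.1 ∂π.channelLaw D ν = ∫⁻ h, f h ∂csiLaw ν :=
  measurePreserving_fst.lintegral_comp hf

variable [IsProbabilityMeasure ν]

theorem lintegral_channelLaw_energy_noise (k : Fin 2) :
    ∫⁻ x, ENNReal.ofReal (energy (x.2 k)) ∂π.channelLaw D ν = π.edgeTime D := by
  rw [← lintegral_energy_receiverNoise, ← lintegral_noiseLaw_eval k (by fun_prop)]
  exact measurePreserving_snd.lintegral_comp (f := fun z : Fin 2 → Signal (π.edgeTime D) =>
    ENNReal.ofReal (energy (z k))) (by fun_prop)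

variable {π} in
theorem PowerConstraint.lintegral_energy_le {P : ℝ} (h : π.PowerConstraint ν P) (m : Fin 2) :
    ∫⁻ F, ∫⁻ x, ENNReal.ofReal (energy (π.codeword m D F x.1)) ∂π.channelLaw D ν ∂libraryLaw J L ≤
      ENNReal.ofReal (π.edgeTime D * P) := by
  have hm : ∀ F, Measurable fun g => ENNReal.ofReal (energy (π.codeword m D F g)) := fun F =>
    (measurable_energy.comp (π.measurable_codeword D m F)).ennreal_ofReal
  have hj : Measurable fun ω : Library J L × CSI =>
      ENNReal.ofReal (energy (π.codeword m D ω.1 ω.2)) :=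
    measurable_from_prod_countable_right hm
  refine le_trans (le_of_eq ?_) (h m D)
  refine Eq.trans ?_ (lintegral_prod _ hj.aemeasurable).symm
  exact lintegral_congr fun F => π.lintegral_channelLaw_fst D (hm F)

theorem energy_received_le {K : ℝ} {g : CSI} (hg : ∀ m k, ‖g m k‖ ≤ K) (k : Fin 2)
    (F : Library J L) (z : Signal (π.edgeTime D)) :
    energy (z + π.noiseless D k F g) ≤ 2 * energy z +
      4 * K ^ 2 * (energy (π.codeword 0 D F g) + energy (π.codeword 1 D F g)) := by
  have h1 := energy_add_le z (π.noiseless D k F g)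
  have h2 := energy_add_le (g 0 k • π.codeword 0 D F g) (g 1 k • π.codeword 1 D F g)
  have h3 : ∀ m, energy (g m k • π.codeword m D F g) ≤ K ^ 2 * energy (π.codeword m D F g) :=
    fun m => by
      rw [energy_smul]
      have := hg m k
      have := energy_nonneg (π.codeword m D F g)
      gcongr
  have h30 := h3 0
  have h31 := h3 1
  have h4 : π.noiseless D k F g = g 0 k • π.codeword 0 D F g + g 1 k • π.codeword 1 D F g :=
    Fin.sum_univ_two _
  rw [h4] at h1 ⊢
  linarith

/-- With gains at most `K`, the power constraint makes the expected received energy `O(n P)`.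
Divided by the reference power `P` it is `O(n)`, so the leading term is the normalization `n log P`.
-/
theorem lintegral_cost_received_le {P K : ℝ} (hP : 1 < P) (hpow : π.PowerConstraint ν P)
    (A : Finset (Fin 2)) {G : Set CSI} (hG : MeasurableSet G)
    (hGK : ∀ g ∈ G, ∀ m k, ‖g m k‖ ≤ K) (k : Fin 2) :
    ∫⁻ F, ∫⁻ x in π.goodSet D A G F,
        ENNReal.ofReal (gaussianCost P (x.2 k + π.noiseless D k F x.1)) ∂π.channelLaw D ν
        ∂libraryLaw J L ≤
      ENNReal.ofReal (π.edgeTime D * (Real.log P + (2 + 8 * K ^ 2))) := by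
  have hP0 : 0 < P := by linarith
  have hlog : 0 ≤ Real.log P := Real.log_nonneg hP.le
  set n := π.edgeTime D
  have hm : ∀ m F, Measurable fun x : CSI × (Fin 2 → Signal n) =>
      ENNReal.ofReal (energy (π.codeword m D F x.1)) := fun m F =>
    (measurable_energy.comp ((π.measurable_codeword D m F).comp measurable_fst)).ennreal_ofReal
  have hpt : ∀ F, ∀ x ∈ π.goodSet D A G F,
      ENNReal.ofReal (gaussianCost P (x.2 k + π.noiseless D k F x.1)) ≤
        ENNReal.ofReal (n * Real.log P) + (2 * ENNReal.ofReal (energy (x.2 k)) +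
        ENNReal.ofReal (4 * K ^ 2 / P) * (ENNReal.ofReal (energy (π.codeword 0 D F x.1)) +
          ENNReal.ofReal (energy (π.codeword 1 D F x.1)))) := fun F x hx => by
    have e0 := energy_nonneg (π.codeword 0 D F x.1)
    have e1 := energy_nonneg (π.codeword 1 D F x.1)
    have ez := energy_nonneg (x.2 k)
    rw [← ENNReal.ofReal_add e0 e1, ← ENNReal.ofReal_mul (by positivity),
      ← ENNReal.ofReal_ofNat 2, ← ENNReal.ofReal_mul (by norm_num),
      ← ENNReal.ofReal_add (by positivity) (by positivity),
      ← ENNReal.ofReal_add (by positivity) (by positivity)]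
    refine ENNReal.ofReal_le_ofReal ?_
    have h1 := π.energy_received_le D (hGK x.1 hx.1) k F (x.2 k)
    have h2 : energy (x.2 k) / P ≤ energy (x.2 k) := div_le_self ez hP.le
    rw [gaussianCost]
    have h3 := div_le_div_of_nonneg_right h1 hP0.le
    have h4 : (2 * energy (x.2 k) + 4 * K ^ 2 * (energy (π.codeword 0 D F x.1) +
        energy (π.codeword 1 D F x.1))) / P = 2 * (energy (x.2 k) / P) + 4 * K ^ 2 / P *
        (energy (π.codeword 0 D F x.1) + energy (π.codeword 1 D F x.1)) := by ring
    linarith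
  calc _ ≤ ∫⁻ F, ∫⁻ x, (ENNReal.ofReal (n * Real.log P) + (2 * ENNReal.ofReal (energy (x.2 k)) +
        ENNReal.ofReal (4 * K ^ 2 / P) * (ENNReal.ofReal (energy (π.codeword 0 D F x.1)) +
          ENNReal.ofReal (energy (π.codeword 1 D F x.1))))) ∂π.channelLaw D ν ∂libraryLaw J L :=
        lintegral_mono fun F =>
          (setLIntegral_mono' (π.measurableSet_goodSet D A hG F) (hpt F)).trans
            (setLIntegral_le_lintegral _ _)
    _ = ENNReal.ofReal (n * Real.log P) + (2 * n + ENNReal.ofReal (4 * K ^ 2 / P) *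
        (∫⁻ F, ∫⁻ x, ENNReal.ofReal (energy (π.codeword 0 D F x.1)) ∂π.channelLaw D ν
            ∂libraryLaw J L +
          ∫⁻ F, ∫⁻ x, ENNReal.ofReal (energy (π.codeword 1 D F x.1)) ∂π.channelLaw D ν
            ∂libraryLaw J L)) := by
        have : ∀ F, ∫⁻ x, (ENNReal.ofReal (n * Real.log P) + (2 * ENNReal.ofReal (energy (x.2 k)) +
            ENNReal.ofReal (4 * K ^ 2 / P) * (ENNReal.ofReal (energy (π.codeword 0 D F x.1)) +
            ENNReal.ofReal (energy (π.codeword 1 D F x.1))))) ∂π.channelLaw D ν =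
            ENNReal.ofReal (n * Real.log P) + (2 * n + ENNReal.ofReal (4 * K ^ 2 / P) *
            (∫⁻ x, ENNReal.ofReal (energy (π.codeword 0 D F x.1)) ∂π.channelLaw D ν +
            ∫⁻ x, ENNReal.ofReal (energy (π.codeword 1 D F x.1)) ∂π.channelLaw D ν)) := fun F => by
          rw [lintegral_add_left measurable_const, lintegral_add_left (by fun_prop),
            lintegral_const_mul _ (by fun_prop), lintegral_const_mul _ (Measurable.fun_add (hm 0 F) (hm 1 F)),
            lintegral_add_left (hm 0 F), lintegral_channelLaw_energy_noise]
          simp [n]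
        simp_rw [this]
        rw [lintegral_add_left .of_discrete, lintegral_add_left .of_discrete,
          lintegral_const_mul _ .of_discrete, lintegral_const_mul _ .of_discrete,
          lintegral_add_left .of_discrete]
        simp
    _ ≤ ENNReal.ofReal (n * Real.log P) + (2 * n + ENNReal.ofReal (4 * K ^ 2 / P) *
        (ENNReal.ofReal (n * P) + ENNReal.ofReal (n * P))) := by
        gcongr
        · exact hpow.lintegral_energy_le D 0
        · exact hpow.lintegral_energy_le D 1
    _ = _ := by
        rw [← ENNReal.ofReal_add (by positivity) (by positivity),
          ← ENNReal.ofReal_mul (by positivity), ← ENNReal.ofReal_ofNat 2,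
          ← ENNReal.ofReal_natCast, ← ENNReal.ofReal_mul (by norm_num),
          ← ENNReal.ofReal_add (by positivity) (by positivity),
          ← ENNReal.ofReal_add (by positivity) (by positivity)]
        congr 1
        field_simp
        ring

/-- The residual noise has bounded power per symbol and is compared with a unit-power reference,
where `log 1 = 0`. Hence no `log P` appears. -/
theorem lintegral_cost_residual_le {R : ℝ} (A : Finset (Fin 2)) {G : Set CSI}
    (hG : MeasurableSet G) {ρ : CSI → ℂ} (hρ : ∀ g ∈ G, ‖ρ g‖ ≤ R) (k l : Fin 2) :
    ∫⁻ F, ∫⁻ x in π.goodSet D A G F,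
        ENNReal.ofReal (gaussianCost 1 (x.2 l - ρ x.1 • x.2 k)) ∂π.channelLaw D ν
        ∂libraryLaw J L ≤
      ENNReal.ofReal (π.edgeTime D * (2 + 2 * R ^ 2)) := by
  set n := π.edgeTime D
  have hpt : ∀ F, ∀ x ∈ π.goodSet D A G F,
      ENNReal.ofReal (gaussianCost 1 (x.2 l - ρ x.1 • x.2 k)) ≤
        2 * ENNReal.ofReal (energy (x.2 l)) +
          ENNReal.ofReal (2 * R ^ 2) * ENNReal.ofReal (energy (x.2 k)) := fun F x hx => by
    have ek := energy_nonneg (x.2 k)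
    have el := energy_nonneg (x.2 l)
    rw [← ENNReal.ofReal_mul (by positivity),
      ← ENNReal.ofReal_ofNat 2, ← ENNReal.ofReal_mul (by norm_num),
      ← ENNReal.ofReal_add (by positivity) (by positivity)]
    refine ENNReal.ofReal_le_ofReal ?_
    have h1 := energy_add_le (x.2 l) ((-ρ x.1) • x.2 k)
    rw [energy_smul, norm_neg, neg_smul, ← sub_eq_add_neg] at h1
    have h2 : ‖ρ x.1‖ ^ 2 * energy (x.2 k) ≤ R ^ 2 * energy (x.2 k) := by
      have := hρ x.1 hx.1
      gcongr
    rw [gaussianCost, Real.log_one, mul_zero, zero_add, div_one]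
    linarith
  calc _ ≤ ∫⁻ _, ∫⁻ x, (2 * ENNReal.ofReal (energy (x.2 l)) +
          ENNReal.ofReal (2 * R ^ 2) * ENNReal.ofReal (energy (x.2 k))) ∂π.channelLaw D ν
          ∂libraryLaw J L :=
        lintegral_mono fun F =>
          (setLIntegral_mono' (π.measurableSet_goodSet D A hG F) (hpt F)).trans
            (setLIntegral_le_lintegral _ _)
    _ = 2 * n + ENNReal.ofReal (2 * R ^ 2) * n := by
        rw [lintegral_add_left (by fun_prop), lintegral_const_mul _ (by fun_prop),
          lintegral_const_mul _ (by fun_prop), lintegral_channelLaw_energy_noise,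
          lintegral_channelLaw_energy_noise]
        simp [n]
    _ = _ := by
        rw [← ENNReal.ofReal_ofNat 2, ← ENNReal.ofReal_natCast, ← ENNReal.ofReal_mul (by norm_num),
          ← ENNReal.ofReal_mul (by positivity),
          ← ENNReal.ofReal_add (by positivity) (by positivity)]
        congr 1
        ring

variable {π}

theorem CacheConstraint.lintegral_entropy_le {μ : Fin 2 → Fin J → ℝ} (h : π.CacheConstraint μ)
    (m : Fin 2) (j : Fin J) :
    ∫⁻ _, ENNReal.ofReal (entropy (libraryLaw J L) fun F => π.cache m j (F j)) ∂csiLaw ν ≤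
      ENNReal.ofReal (μ m j * L) := by
  simpa using ENNReal.ofReal_le_ofReal (h m j)

theorem FronthaulConstraint.lintegral_entropy_le {r P : ℝ} (h : π.FronthaulConstraint ν r P)
    (m : Fin 2) :
    ∫⁻ g, ENNReal.ofReal (entropy (libraryLaw J L) fun F => π.fronthaul m D F g) ∂csiLaw ν ≤
      ENNReal.ofReal (r * Real.logb 2 P * π.fronthaulTime D) := by
  have hm : Measurable fun g => entropy (libraryLaw J L) fun F => π.fronthaul m D F g :=
    measurable_entropy _ (π.measurable_fronthaul m D)
  rw [← ofReal_integral_eq_lintegral_ofReal]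
  · exact ENNReal.ofReal_le_ofReal (h m D)
  -- The constraint is a Bochner integral, so integrability is needed to exclude its default value
  -- 0. The entropy of the whole library is a bound uniform in the channel.
  · refine Integrable.of_bound hm.aestronglyMeasurable
      ((∑ F, (libraryLaw J L).real {F} * -Real.log ((libraryLaw J L).real {F})) / Real.log 2)
      (ae_of_all _ fun g => ?_)
    rw [Real.norm_of_nonneg (entropy_nonneg _ _), le_div_iff₀ (Real.log_pos one_lt_two)]
    exact entropy_mul_log_two_le _ libraryLaw_real_singleton_pos _
  · exact ae_of_all _ fun g => entropy_nonneg _ _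

/-- A user decodes its file from its received signal alone. -/
theorem edge_bound {P K : ℝ} (hP : 1 < P) (hpow : π.PowerConstraint ν P) {G : Set CSI}
    (hG : MeasurableSet G) (hGK : ∀ g ∈ G, ∀ m k, ‖g m k‖ ≤ K) (k : Fin 2) :
    ((csiLaw ν).real G - π.maxErrorProb ν) * (L * Real.log 2) ≤
      1 + π.edgeTime D * (Real.log P + (2 + 8 * K ^ 2)) := by
  have hlog : 0 ≤ Real.log P := Real.log_nonneg hP.le
  have hP0 : 0 < P := by linarith
  have := isProbabilityMeasure_gaussianRef (π.edgeTime D) hP0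
  have h := π.correct_mul_log_le D ν {k} hG (ι := Empty) (V := fun i => i.elim) (fun i => i.elim)
    (cost := fun F x => gaussianCost P (x.2 k + π.noiseless D k F x.1)) (fun F => by fun_prop)
    (c := π.edgeTime D * (Real.log P + (2 + 8 * K ^ 2))) (by positivity) (b := fun i => i.elim)
    (fun i => i.elim) (ae_of_all _ fun g => ?_)
    (π.lintegral_cost_received_le D hP hpow {k} hG hGK k) (fun i => i.elim)
  · simpa using h
  · refine le_trans (lintegral_mono fun F => mul_le_mul' le_rfl ?_)
      ((lintegral_prod_likelihood_mul_le (gaussianRef (π.edgeTime D) P)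
        (S := fun F => π.decisionRegion D k g (F (D k)))
        (fun F => π.measurableSet_decisionRegion D k g _) (fun (i : Empty) _ => i.elim)
        {D k} ?_).trans_eq (by simp))
    · refine le_trans (lintegral_mono fun z => ?_) (lintegral_tilt_one_user_le k P
        (π.noiseless D k F g) (π.measurableSet_decisionRegion D k g (F (D k))))
      by_cases hz : (g, z) ∈ π.goodSet D {k} G F
      · have : z k + π.noiseless D k F g ∈ π.decisionRegion D k g (F (D k)) :=
          hz.2 k (Finset.mem_singleton_self k)
        simp [hz, this]
      · simp [hz]
    · intro y F F' hF hF' hr _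
      funext j
      by_cases hj : j = D k
      · rw [hj]
        exact hF.symm.trans hF'
      · exact hr j (by simpa using hj)

theorem codeword_congr {m : Fin 2} {F F' : Library J L} {g : CSI}
    (hc : ∀ j, π.cache m j (F j) = π.cache m j (F' j))
    (hu : π.fronthaul m D F g = π.fronthaul m D F' g) :
    π.codeword m D F g = π.codeword m D F' g := by
  rw [codeword, codeword, hu, funext hc]

/-- The users in `A` decode their files from the cached contents and fronthaul messages. -/
theorem fronthaul_bound {r P : ℝ} (hr : 0 < r) (hP : 1 < P) {μ : Fin 2 → Fin J → ℝ}
    (hμ : ∀ m j, 0 ≤ μ m j) (hcache : π.CacheConstraint μ) (hfront : π.FronthaulConstraint ν r P)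
    (A : Finset (Fin 2)) :
    (1 - A.card * π.maxErrorProb ν) * (A.card * (L * Real.log 2)) ≤
      1 + (2 * (r * Real.logb 2 P * π.fronthaulTime D) + (∑ m, ∑ k ∈ A, μ m (D k)) * L) *
        Real.log 2 := by
  have hlog : 0 ≤ Real.logb 2 P := Real.logb_nonneg one_lt_two hP.le
  have h := π.correct_mul_log_le D ν A MeasurableSet.univ (ι := Fin 2 ⊕ Fin 2 × A)
    (V := Sum.elim (fun m F g => π.fronthaul m D F g)
      (fun i F _ => π.cache i.1 (D i.2) (F (D i.2))))
    (by
      rintro (m | i) F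
      · exact π.measurable_fronthaul m D F
      · exact measurable_const)
    -- No change of measure is needed: the noise is already independent of the files, and the side
    -- information determines everything else in the received signals.
    (cost := fun _ _ => 0) (fun _ => measurable_const) (c := 0) le_rfl
    (b := Sum.elim (fun _ => r * Real.logb 2 P * π.fronthaulTime D)
      (fun i => μ i.1 (D i.2) * L))
    (by
      rintro (m | i)
      · dsimp only [Sum.elim_inl]; positivity
      · exact mul_nonneg (hμ _ _) (Nat.cast_nonneg _))
    (ae_of_all _ fun g => ?_) (by simp)
    (by
      rintro (m | i)
      · exact hfront.lintegral_entropy_le D m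
      · exact hcache.lintegral_entropy_le i.1 (D i.2))
  · simp only [probReal_univ, add_zero, Fintype.sum_sum_type, Sum.elim_inl, Sum.elim_inr,
      Fintype.sum_prod_type, Finset.sum_const, Finset.card_univ, Fintype.card_fin] at h
    convert h using 3
    rw [nsmul_eq_mul, Nat.cast_ofNat, Finset.sum_mul]
    congr 1
    refine Finset.sum_congr rfl fun m _ => ?_
    rw [Finset.sum_mul, ← Finset.sum_coe_sort A]
  · refine le_trans (lintegral_mono fun F => mul_le_mul' le_rfl ?_)
      ((lintegral_prod_likelihood_mul_le (noiseLaw (π.edgeTime D))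
        (S := fun F => Prod.mk g ⁻¹' π.goodSet D A Set.univ F)
        (fun F => measurable_prodMk_left (π.measurableSet_goodSet D A MeasurableSet.univ F))
        (fun i F => Sum.elim (fun m F g => π.fronthaul m D F g)
          (fun (i : Fin 2 × A) F _ => π.cache i.1 (D i.2) (F (D i.2))) i F g)
        (A.map D) ?_).trans_eq (by simp))
    · rw [← lintegral_indicator_one
        (measurable_prodMk_left (π.measurableSet_goodSet D A MeasurableSet.univ F))]
      refine lintegral_mono fun z => ?_
      by_cases hz : (g, z) ∈ π.goodSet D A Set.univ F <;> simp [hz]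
    · intro z F F' hF hF' hrest hV
      have hcw : ∀ m, π.codeword m D F g = π.codeword m D F' g := fun m => by
        refine codeword_congr D (fun j => ?_) (hV (Sum.inl m))
        by_cases hj : j ∈ A.map D
        · obtain ⟨k, hk, rfl⟩ := Finset.mem_map.1 hj
          exact hV (Sum.inr (m, ⟨k, hk⟩))
        · rw [hrest j hj]
      funext j
      by_cases hj : j ∈ A.map D
      · obtain ⟨k, hk, rfl⟩ := Finset.mem_map.1 hj
        have h1 : π.decode k D _ g = F (D k) := hF.2 k hk
        have h2 : π.decode k D _ g = F' (D k) := hF'.2 k hk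
        rw [← h1, ← h2]
        simp only [noiseless, hcw]
      · exact hrest j hj

theorem noiseless_eq_of_ne {m m' : Fin 2} (hm : m ≠ m') (k : Fin 2) (F : Library J L) (g : CSI) :
    π.noiseless D k F g = g m k • π.codeword m D F g + g m' k • π.codeword m' D F g := by
  have hc : (m = 0 ∧ m' = 1) ∨ (m = 1 ∧ m' = 0) := by omega
  rw [noiseless, Fin.sum_univ_two]
  rcases hc with ⟨rfl, rfl⟩ | ⟨rfl, rfl⟩
  · rfl
  · exact add_comm _ _

/-- Both files are decoded from the signal received by user `k`, the fronthaul message of EN `m`,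
and the content that EN `m` caches of the file of the other user. -/
theorem edge_fronthaul_bound {r P K : ℝ} (hr : 0 < r) (hP : 1 < P) {μ : Fin 2 → Fin J → ℝ}
    (hμ : ∀ m j, 0 ≤ μ m j) (hcache : π.CacheConstraint μ) (hfront : π.FronthaulConstraint ν r P)
    (hpow : π.PowerConstraint ν P) {G : Set CSI} (hG : MeasurableSet G)
    (hGK : ∀ g ∈ G, ∀ m k, ‖g m k‖ ≤ K) (hGK' : ∀ g ∈ G, ∀ m k, 1 ≤ K * ‖g m k‖)
    {m m' : Fin 2} (hm : m ≠ m') {k l : Fin 2} (hkl : k ≠ l) :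
    ((csiLaw ν).real G - 2 * π.maxErrorProb ν) * (2 * (L * Real.log 2)) ≤
      1 + π.edgeTime D * (Real.log P + (2 + 8 * K ^ 2) + (2 + 2 * (K ^ 2) ^ 2)) +
        (r * Real.logb 2 P * π.fronthaulTime D + μ m (D l) * L) * Real.log 2 := by
  have hlog : 0 ≤ Real.log P := Real.log_nonneg hP.le
  have hlogb : 0 ≤ Real.logb 2 P := Real.logb_nonneg one_lt_two hP.le
  have hP0 : 0 < P := by linarith
  have := isProbabilityMeasure_gaussianRef (π.edgeTime D) hP0
  have := isProbabilityMeasure_gaussianRef (π.edgeTime D) one_pos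
  have huniv : ∀ j : Fin 2, j = k ∨ j = l := fun j => by omega
  -- This ratio cancels `X_{m'}` in `Y_l - ρ Y_k`. The remaining coefficient of `X_m` may vanish,
  -- since `X_m` is known from the side information.
  let ρ : CSI → ℂ := fun g => g m' l / g m' k
  have hρm : Measurable ρ := by fun_prop
  have hρ : ∀ g ∈ G, ‖ρ g‖ ≤ K ^ 2 := fun g hg => by
    have h1 := hGK g hg m' l
    have h2 := hGK' g hg m' k
    have h3 : 0 ≤ ‖g m' l‖ := norm_nonneg _
    have h4 : 0 < ‖g m' k‖ := by
      rcases (norm_nonneg (g m' k)).eq_or_lt with h | h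
      · rw [← h] at h2; linarith
      · exact h
    rw [norm_div, div_le_iff₀ h4]
    nlinarith
  have hc1 : 0 ≤ π.edgeTime D * (Real.log P + (2 + 8 * K ^ 2)) := by positivity
  have hc2 : 0 ≤ π.edgeTime D * (2 + 2 * (K ^ 2) ^ 2) := by positivity
  have hmc : ∀ F, Measurable fun x : CSI × (Fin 2 → Signal (π.edgeTime D)) =>
      gaussianCost P (x.2 k + π.noiseless D k F x.1) := fun F => by fun_prop
  have hmr : Measurable fun x : CSI × (Fin 2 → Signal (π.edgeTime D)) =>
      gaussianCost 1 (x.2 l - ρ x.1 • x.2 k) := by fun_prop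
  have h := π.correct_mul_log_le D ν Finset.univ hG (ι := Fin 2)
    (V := ![fun F g => π.fronthaul m D F g, fun F _ => π.cache m (D l) (F (D l))])
    (by
      refine Fin.forall_fin_two.2 ⟨fun F => ?_, fun F => ?_⟩
      · exact π.measurable_fronthaul m D F
      · exact measurable_const)
    (cost := fun F x => gaussianCost P (x.2 k + π.noiseless D k F x.1) +
      gaussianCost 1 (x.2 l - ρ x.1 • x.2 k)) (fun F => (hmc F).add hmr)
    (c := π.edgeTime D * (Real.log P + (2 + 8 * K ^ 2)) +
      π.edgeTime D * (2 + 2 * (K ^ 2) ^ 2)) (add_nonneg hc1 hc2)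
    (b := ![r * Real.logb 2 P * π.fronthaulTime D, μ m (D l) * L])
    (by
      refine Fin.forall_fin_two.2 ⟨?_, ?_⟩
      · change 0 ≤ r * Real.logb 2 P * π.fronthaulTime D
        positivity
      · exact mul_nonneg (hμ _ _) (Nat.cast_nonneg _))
    (ae_of_all _ fun g => ?_)
    (by
      rw [ENNReal.ofReal_add hc1 hc2]
      refine le_trans (lintegral_mono fun F => lintegral_mono fun x =>
        ENNReal.ofReal_add_le) ?_
      simp_rw [fun F => lintegral_add_left
        (μ := (π.channelLaw D ν).restrict (π.goodSet D Finset.univ G F)) (hmc F).ennreal_ofReal]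
      rw [lintegral_add_left .of_discrete]
      exact add_le_add (π.lintegral_cost_received_le D hP hpow _ hG hGK k)
        (π.lintegral_cost_residual_le D _ hG hρ k l))
    (by
      refine Fin.forall_fin_two.2 ⟨?_, ?_⟩
      · exact hfront.lintegral_entropy_le D m
      · exact hcache.lintegral_entropy_le m (D l))
  · simp only [Finset.card_univ, Fintype.card_fin, Nat.cast_ofNat, Fin.sum_univ_two,
      Matrix.cons_val_zero, Matrix.cons_val_one] at h
    linarith
  · by_cases hg : g ∈ G
    · have hne : g m' k ≠ 0 := fun h0 => by
        have := hGK' g hg m' k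
        rw [h0, norm_zero, mul_zero] at this
        linarith
      let S : Library J L → Set (Signal (π.edgeTime D) × Signal (π.edgeTime D)) := fun F =>
        {q | q.1 ∈ π.decisionRegion D k g (F (D k)) ∧
          q.2 + (ρ g • q.1 + (π.noiseless D l F g - ρ g • π.noiseless D k F g)) ∈
            π.decisionRegion D l g (F (D l))}
      have hS : ∀ F, MeasurableSet (S F) := fun F =>
        (measurable_fst (π.measurableSet_decisionRegion D k g _)).inter
          (Measurable.comp (g := fun q : Signal (π.edgeTime D) × Signal (π.edgeTime D) =>
            q.2 + (ρ g • q.1 + (π.noiseless D l F g - ρ g • π.noiseless D k F g)))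
            (by fun_prop) measurable_id (π.measurableSet_decisionRegion D l g _))
      have hdiff : ∀ F, π.noiseless D l F g - ρ g • π.noiseless D k F g =
          (g m l - ρ g * g m k) • π.codeword m D F g := fun F => by
        rw [noiseless_eq_of_ne D hm, noiseless_eq_of_ne D hm, smul_add, smul_smul, smul_smul,
          div_mul_cancel₀ _ hne, sub_smul]
        abel
      refine le_trans (lintegral_mono fun F => mul_le_mul' le_rfl ?_)
        ((lintegral_prod_likelihood_mul_le
          ((gaussianRef (π.edgeTime D) P).prod (gaussianRef (π.edgeTime D) 1)) hS
          (fun i F => ![fun F g => π.fronthaul m D F g,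
            fun F _ => π.cache m (D l) (F (D l))] i F g)
          (Finset.univ.map D) ?_).trans_eq (by simp))
      · refine le_trans (lintegral_mono fun z => ?_) (lintegral_tilt_two_users_le hkl P (ρ g)
          (π.noiseless D k F g) (π.noiseless D l F g)
          (π.measurableSet_decisionRegion D k g (F (D k)))
          (π.measurableSet_decisionRegion D l g (F (D l))))
        by_cases hz : (g, z) ∈ π.goodSet D Finset.univ G F
        · have h1 : z k + π.noiseless D k F g ∈ π.decisionRegion D k g (F (D k)) :=
            hz.2 k (Finset.mem_univ k)
          have h2 : z l + π.noiseless D l F g ∈ π.decisionRegion D l g (F (D l)) :=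
            hz.2 l (Finset.mem_univ l)
          simp [hz, h1, h2]
        · simp [hz]
      · intro q F F' hF hF' hrest hV
        -- Successive decoding: `q.1` fixes the file of `k`, hence the codeword of EN `m`, hence the
        -- reconstructed signal of `l` and its file.
        have hk : F (D k) = F' (D k) := hF.1.symm.trans hF'.1
        have hcw : π.codeword m D F g = π.codeword m D F' g := by
          refine codeword_congr D (fun j => ?_) (hV 0)
          by_cases hj : j ∈ Finset.univ.map D
          · obtain ⟨i, -, rfl⟩ := Finset.mem_map.1 hj
            rcases huniv i with rfl | rfl
            · rw [hk]
            · exact hV 1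
          · rw [hrest j hj]
        have hl : F (D l) = F' (D l) := by
          have h1 := hF.2
          have h2 := hF'.2
          rw [hdiff, hcw] at h1
          rw [hdiff] at h2
          exact h1.symm.trans h2
        funext j
        by_cases hj : j ∈ Finset.univ.map D
        · obtain ⟨i, -, rfl⟩ := Finset.mem_map.1 hj
          rcases huniv i with rfl | rfl
          · exact hk
          · exact hl
        · exact hrest j hj
    · have h0 : ∀ F z, (g, z) ∉ π.goodSet D Finset.univ G F := fun F z hz => hg hz.1
      simp [h0]

end Policy

/-! ### Normalized delivery times -/

/-- The channel states whose coefficients have moduli between `1 / K` and `K`. -/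
def boundedCSI (K : ℝ) : Set CSI := {g | ∀ m k, ‖g m k‖ ≤ K ∧ 1 ≤ K * ‖g m k‖}

theorem measurableSet_boundedCSI (K : ℝ) : MeasurableSet (boundedCSI K) := by
  have h : boundedCSI K = ⋂ m, ⋂ k, ({g : CSI | ‖g m k‖ ≤ K} ∩ {g : CSI | 1 ≤ K * ‖g m k‖}) := by
    ext; simp [boundedCSI]
  rw [h]
  exact MeasurableSet.iInter fun m => MeasurableSet.iInter fun k =>
    (measurableSet_le (by fun_prop) (by fun_prop)).inter
      (measurableSet_le (by fun_prop) (by fun_prop))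

/-- These sets increase to the channel states with all coefficients nonzero, a set of full measure
because `ν` has no atom at zero. -/
theorem tendsto_csiLaw_boundedCSI (ν : Measure ℂ) [IsProbabilityMeasure ν]
    [NullSingletonClass ν] :
    Tendsto (fun N : ℕ => (csiLaw ν).real (boundedCSI N)) atTop (𝓝 1) := by
  have hmono : Monotone fun N : ℕ => boundedCSI N := fun N N' hN g hg m k => by
    have hc : (N : ℝ) ≤ N' := by exact_mod_cast hN
    exact ⟨(hg m k).1.trans hc, (hg m k).2.trans (by gcongr)⟩
  have hunion : ∀ᵐ g ∂csiLaw ν, g ∈ ⋃ N : ℕ, boundedCSI N := by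
    have hne : ∀ᵐ g ∂csiLaw ν, ∀ m k, g m k ≠ 0 := by
      refine ae_all_iff.2 fun m => ae_all_iff.2 fun k => ?_
      have h1 : ∀ᵐ z ∂ν, z ≠ 0 := by simp [ae_iff]
      have h2 := (measurePreserving_eval (fun _ : Fin 2 => ν) k).quasiMeasurePreserving.ae h1
      exact (measurePreserving_eval (fun _ : Fin 2 => Measure.pi fun _ : Fin 2 => ν)
        m).quasiMeasurePreserving.ae h2
    filter_upwards [hne] with g hg
    obtain ⟨N, hN⟩ := exists_nat_ge (∑ m, ∑ k, (‖g m k‖ + ‖g m k‖⁻¹))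
    refine Set.mem_iUnion.2 ⟨N, fun m k => ?_⟩
    have hpos : 0 < ‖g m k‖ := norm_pos_iff.2 (hg m k)
    have hle : ‖g m k‖ + ‖g m k‖⁻¹ ≤ N := by
      refine le_trans ?_ hN
      refine le_trans ?_ (Finset.single_le_sum (f := fun m => ∑ k, (‖g m k‖ + ‖g m k‖⁻¹))
        (fun m _ => by positivity) (Finset.mem_univ m))
      exact Finset.single_le_sum (f := fun k => (‖g m k‖ + ‖g m k‖⁻¹))
        (fun k _ => by positivity) (Finset.mem_univ k)
    have hinv : 0 < ‖g m k‖⁻¹ := inv_pos.2 hpos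
    refine ⟨by linarith, ?_⟩
    rw [← inv_le_iff_one_le_mul₀ hpos]
    linarith
  have h := tendsto_measure_iUnion_atTop (μ := csiLaw ν) hmono
  have h1 : csiLaw ν (⋃ N : ℕ, boundedCSI N) = 1 := by
    rw [measure_congr (show (⋃ N : ℕ, boundedCSI N) =ᵐ[csiLaw ν] Set.univ from
      eventuallyEq_univ.2 hunion), measure_univ]
  rw [h1] at h
  exact (ENNReal.tendsto_toReal ENNReal.one_ne_top).comp h

theorem IteratedLimit.nonneg {n : ℕ → ℝ → ℕ} {δ : ℝ}
    (h : IteratedLimit (fun L P => (n L P : ℝ) / ((L : ℝ) / Real.logb 2 P)) δ) : 0 ≤ δ := by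
  obtain ⟨g, hg, hg'⟩ := h
  refine ge_of_tendsto hg' ?_
  filter_upwards [hg, eventually_gt_atTop 1] with P hP hP1
  have := Real.logb_nonneg one_lt_two hP1.le
  exact ge_of_tendsto' hP fun L => by positivity

/-- Passage to the limit in a finite blocklength bound. -/
theorem IteratedLimit.bound {nf ne ε : ℕ → ℝ → ℝ} {δf δe : ℝ}
    (hf : IteratedLimit (fun L P => nf L P / ((L : ℝ) / Real.logb 2 P)) δf)
    (he : IteratedLimit (fun L P => ne L P / ((L : ℝ) / Real.logb 2 P)) δe)
    (hε : IteratedLimit ε 0) {p a b α β r C θ : ℝ}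
    (h : ∀ (L : ℕ) (P : ℝ), 1 < P → (p - a * ε L P) * (b * (L * Real.log 2)) ≤
      1 + α * (ne L P * (Real.log P + C)) +
        (β * (r * Real.logb 2 P * nf L P) + θ * L) * Real.log 2) :
    p * b ≤ α * δe + β * (r * δf) + θ := by
  obtain ⟨gf, hgf, hgf'⟩ := hf
  obtain ⟨ge, hge, hge'⟩ := he
  obtain ⟨gε, hgε, hgε'⟩ := hε
  have hl2 : 0 < Real.log 2 := Real.log_pos one_lt_two
  have hL : ∀ᶠ P in atTop, (p - a * gε P) * b ≤
      α * (ge P * (1 + C / Real.log P)) + β * (r * gf P) + θ := by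
    filter_upwards [hgf, hge, hgε, eventually_gt_atTop 1] with P h1 h2 h3 hP
    have hlP : 0 < Real.log P := Real.log_pos hP
    have t0 : Tendsto (fun L : ℕ => 1 / (L : ℝ) * (1 / Real.log 2)) atTop (𝓝 0) := by
      simpa using tendsto_one_div_atTop_nhds_zero_nat.mul_const (1 / Real.log 2)
    have hlim : Tendsto (fun L : ℕ => 1 / (L : ℝ) * (1 / Real.log 2) +
        (α * (ne L P / ((L : ℝ) / Real.logb 2 P) * (1 + C / Real.log P)) +
          β * (r * (nf L P / ((L : ℝ) / Real.logb 2 P))) + θ)) atTop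
        (𝓝 (0 + (α * (ge P * (1 + C / Real.log P)) + β * (r * gf P) + θ))) :=
      t0.add ((((h2.mul_const _).const_mul α).add ((h1.const_mul r).const_mul β)).add_const θ)
    rw [zero_add] at hlim
    -- For fixed `P` the bound is divided by `L * log 2`. The edge term becomes the normalized time
    -- multiplied by `1 + C / log P`, and the additive 1 vanishes with `L`.
    refine le_of_tendsto_of_tendsto (((h3.const_mul a).const_sub p).mul_const b) hlim ?_
    filter_upwards [eventually_ge_atTop 1] with L hL
    have hL0 : (0 : ℝ) < L := by exact_mod_cast hL
    have hfin := h L P hP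
    have hpos : 0 < L * Real.log 2 := by positivity
    rw [← mul_le_mul_iff_of_pos_right hpos]
    refine le_trans (le_of_eq (by ring)) (hfin.trans (le_of_eq ?_))
    rw [Real.logb]
    field_simp
    ring
  have hC : Tendsto (fun P => C / Real.log P) atTop (𝓝 0) :=
    Real.tendsto_log_atTop.const_div_atTop C
  have hl := ((hgε'.const_mul a).const_sub p).mul_const b
  have hr := ((((hge'.mul (hC.const_add 1)).const_mul α).add
    ((hgf'.const_mul r).const_mul β)).add_const θ)
  simpa using le_of_tendsto_of_tendsto hl hr hL

/-! ### The three inequalities between the limiting delivery times -/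

section Converse

variable {J : ℕ} {ν : Measure ℂ} [IsProbabilityMeasure ν] {r : ℝ}
  {μ : Fin 2 → Fin J → ℝ} {π : (L : ℕ) → ℝ → Policy J L} (hπ : IsFeasible ν r μ π)
  (D : Demand J) {δf δe : ℝ}
  (hf : IteratedLimit
    (fun L P => ((π L P).fronthaulTime D : ℝ) / ((L : ℝ) / Real.logb 2 P)) δf)
  (he : IteratedLimit
    (fun L P => ((π L P).edgeTime D : ℝ) / ((L : ℝ) / Real.logb 2 P)) δe)

include hπ hf he

theorem IsFeasible.one_le_edge [NullSingletonClass ν] : 1 ≤ δe := by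
  -- `N` is fixed while `L` and `P` tend to infinity, because the constant `C` below grows with `N`.
  refine le_of_tendsto' (tendsto_csiLaw_boundedCSI ν) fun N => ?_
  have h := hf.bound he hπ.error (p := (csiLaw ν).real (boundedCSI N)) (a := 1) (b := 1) (α := 1)
    (β := 0) (r := r) (C := 2 + 8 * (N : ℝ) ^ 2) (θ := 0) fun L P hP => by
      have := Policy.edge_bound D hP (hπ.power L P hP) (measurableSet_boundedCSI N)
        (fun g hg m k => (hg m k).1) 0
      linarith
  linarith

theorem IsFeasible.two_le_edge_add_fronthaul [NullSingletonClass ν] (hr : 0 < r)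
    (hμ : ∀ m j, 0 ≤ μ m j) (m l : Fin 2) : 2 ≤ δe + r * δf + μ m (D l) := by
  obtain ⟨m', hm⟩ : ∃ m', m ≠ m' := ⟨m + 1, by omega⟩
  obtain ⟨k, hkl⟩ : ∃ k, k ≠ l := ⟨l + 1, by omega⟩
  have ht := (tendsto_csiLaw_boundedCSI ν).mul_const 2
  rw [one_mul] at ht
  refine le_of_tendsto' ht fun N => ?_
  have h := hf.bound he hπ.error (p := (csiLaw ν).real (boundedCSI N)) (a := 2) (b := 2) (α := 1)
    (β := 1) (r := r) (C := 2 + 8 * (N : ℝ) ^ 2 + (2 + 2 * ((N : ℝ) ^ 2) ^ 2)) (θ := μ m (D l))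
    fun L P hP => by
      have := Policy.edge_fronthaul_bound D hr hP hμ (hπ.cache L P hP) (hπ.fronthaul L P hP)
        (hπ.power L P hP) (measurableSet_boundedCSI N) (fun g hg m k => (hg m k).1)
        (fun g hg m k => (hg m k).2) hm hkl
      linarith
  linarith

theorem IsFeasible.card_le_fronthaul (hr : 0 < r) (hμ : ∀ m j, 0 ≤ μ m j) (A : Finset (Fin 2)) :
    (A.card : ℝ) ≤ 2 * (r * δf) + ∑ m, ∑ k ∈ A, μ m (D k) := by
  have h := hf.bound he hπ.error (p := 1) (a := A.card) (b := A.card) (α := 0) (β := 2) (r := r)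
    (C := 0) (θ := ∑ m, ∑ k ∈ A, μ m (D k)) fun L P hP => by
      have := Policy.fronthaul_bound D hr hP hμ (hπ.cache L P hP) (hπ.fronthaul L P hP) A
      linarith
  linarith

end Converse

/-- With `s = r y`, the NDT `x + y` is `(x + s) + (1/r - 1) s`. For `r ≤ 1` the last coefficient is
nonnegative, and the lower bounds on `s` from both files, from one file and from `0 ≤ s` give the
three terms. For `r > 1` the decomposition `(1/r) (x + s) + (1 - 1/r) x` is used with `1 ≤ x`. -/
theorem outerBound_le {J : ℕ} {μ : Fin 2 → Fin J → ℝ} {r : ℝ} (hr : 0 < r) {i j : Fin J}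
    {x y : ℝ} (hx : 1 ≤ x) (hy : 0 ≤ y) (hi : ∀ m, 2 ≤ x + r * y + μ m i) (hj : ∀ m, 2 ≤ x + r * y + μ m j)
    (hij : 2 ≤ 2 * (r * y) + (μ 0 i + μ 1 i + μ 0 j + μ 1 j))
    (hyi : 1 ≤ 2 * (r * y) + (μ 0 i + μ 1 i)) (hyj : 1 ≤ 2 * (r * y) + (μ 0 j + μ 1 j)) :
    outerBound μ r i j ≤ x + y := by
  have hmin : 2 - (x + r * y) ≤ minCache μ i j := by
    refine le_min (le_min ?_ ?_) (le_min ?_ ?_)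
    · linarith [hi 0]
    · linarith [hi 1]
    · linarith [hj 0]
    · linarith [hj 1]
  have hmin' : 1 - 2 * (r * y) ≤ min (μ 0 i + μ 1 i) (μ 0 j + μ 1 j) :=
    le_min (by linarith) (by linarith)
  -- This makes `1 / r` the only form in which `r` enters the products left to `nlinarith`.
  obtain ⟨s, rfl⟩ : ∃ s, y = 1 / r * s := ⟨r * y, by field_simp⟩
  have hs : r * (1 / r * s) = s := by field_simp
  rw [hs] at hmin hmin' hij
  unfold outerBound
  split_ifs with h1
  · have hr1 : 0 ≤ 1 / r - 1 := by
      rw [sub_nonneg, le_div_iff₀ hr]; linarith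
    refine max_le ?_ (max_le ?_ ?_)
    · unfold outer1
      nlinarith [mul_le_mul_of_nonneg_left hij hr1]
    · unfold outer2
      have h2 : 3 / 2 + 1 / (2 * r) = 2 + 1 / 2 * (1 / r - 1) := by
        field_simp; ring
      rw [h2]
      nlinarith [mul_le_mul_of_nonneg_left hmin' hr1]
    · unfold outer3
      have hs0 : 0 ≤ s := hs ▸ mul_nonneg hr.le hy
      nlinarith
  · have hr1 : 1 / r ≤ 1 := by
      rw [div_le_one hr]; linarith
    have hr0 : 0 < 1 / r := by positivity
    unfold outer4
    nlinarith [mul_le_mul_of_nonneg_left hmin hr0.le,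
      mul_le_mul_of_nonneg_left hx (sub_nonneg.2 hr1)]

end FRAN

end

theorem theorem2 {J : ℕ} (ν : MeasureTheory.Measure ℂ) [MeasureTheory.IsProbabilityMeasure ν]
    [MeasureTheory.NullSingletonClass ν] (r : ℝ) (hr : 0 < r) (μ : Fin 2 → Fin J → ℝ)
    (hμ : ∀ m j, μ m j ∈ Set.Icc (0 : ℝ) 1) :
    FRAN.ndtRegion ν r μ ⊆ FRAN.outerRegion μ r := by
  rintro δ ⟨π, hπ, δf, δe, hf, he, hδ⟩ i j hij
  -- One ordering of the request suffices, since the inequalities hold for both users.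
  let D : FRAN.Demand J := ⟨![i, j], by
    intro a b hab
    fin_cases a <;> fin_cases b <;> simp_all [eq_comm]⟩
  have hD : FRAN.pairSet i j hij = D.toSet := by
    refine Subtype.ext ?_
    ext x
    simp only [FRAN.pairSet, FRAN.Demand.toSet, Finset.mem_insert, Finset.mem_singleton,
      Finset.mem_map, Finset.mem_univ, true_and, Fin.exists_fin_two, eq_comm (a := x)]
    rfl
  have h0 : ∀ m j, 0 ≤ μ m j := fun m j => (hμ m j).1
  have h2 := hπ.two_le_edge_add_fronthaul D (hf D) (he D) hr h0
  have hA := hπ.card_le_fronthaul D (hf D) (he D) hr h0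
  rw [hD, hδ]
  refine FRAN.outerBound_le hr (hπ.one_le_edge D (hf D) (he D)) (hf D).nonneg (fun m => h2 m 0) (fun m => h2 m 1)
    ?_ ?_ ?_
  · have := hA Finset.univ
    simp only [Finset.card_univ, Fintype.card_fin, Fin.sum_univ_two, Nat.cast_ofNat] at this
    change 2 ≤ 2 * (r * δf D) + (μ 0 (D 0) + μ 1 (D 0) + μ 0 (D 1) + μ 1 (D 1))
    linarith
  · have := hA {0}
    simp only [Finset.card_singleton, Finset.sum_singleton, Fin.sum_univ_two, Nat.cast_one] at this
    exact this
  · have := hA {1}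
    simp only [Finset.card_singleton, Finset.sum_singleton, Fin.sum_univ_two, Nat.cast_one] at this
    exact this
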